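/- Let $n\ge 1$, let $\zeta_1,\dots,\zeta_n$ be distinct points of the unit circle $\partial\mathbb D$, let $b_1,\dots,b_n>0$ and $a\in\mathbb R$. Put $b=\sum_k b_k$, $\psi=\operatorname{Arccot}(a/b)-\frac{\pi}{2}\in(-\frac\pi2,\frac\pi2)$ (where $\operatorname{Arccot}$ takes values in $(0,\pi)$, so $\psi=-\arctan(a/b)$), $R(z)=\prod_k(\zeta_k-z)$ and $Q(z)=\sum_k b_k(\zeta_k+z)\prod_{j\ne k}(\zeta_j-z)$. (1) The polynomial $Q-iaR$ has leading term $(-1)^{n-1}(b+ia)z^n$, and its roots $\xi_1,\dots,\xi_n$ are distinct points of $\partial\mathbb D\setminus\{\zeta_1,\dots,\zeta_n\}$. The numbers $\alpha_k$ defined by $$\frac{R(\xi_k)}{\xi_k\prod_{j\ne k}(\xi_k-\xi_j)}=2(-1)^{n-1}e^{-i\psi}\alpha_k$$ are real and negative, and $\sum_k\alpha_k=-\cos\psi$. (2) Let $\phi$ be given in $\mathbb D$ by any holomorphic branch of $$\phi(z)=z\Big(\prod_{k=1}^n(z-\xi_k)^{2\alpha_k}\Big)^{e^{i\psi}}$$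 (such branches exist). Then $\phi$ is $\psi$-spirallike: it is holomorphic and univalent in $\mathbb D$, $\phi(0)=0$, and $\phi(\mathbb D)$ is a simply connected domain that contains $w\exp(-e^{i\psi}t)$ whenever $w\in\phi(\mathbb D)$ and $t\ge 0$. (3) For $z\in\mathbb D$ and $t\ge0$ the point $e^{-(b-ia)t}\phi(e^{-iat}z)$ lies in $\phi(\mathbb D)$, and $$f(z,t)=\phi^{-1}\big(e^{-(b-ia)t}\phi(e^{-iat}z)\big)$$ is the unique solution of the radial Loewner--Kufarev equation driven by the measures $\sum_k b_k\delta_{e^{iat}\zeta_k}$, $$\frac{\partial f}{\partial t}(z,t)=-f'(z,t)\,z\sum_{k=1}^n b_k\frac{e^{iat}\zeta_k+z}{e^{iat}\zeta_k-z}\quad(z\in\mathbb D,\ t\ge0),\qquad f(z,0)=z,$$ where $f'=\partial f/\partial z$. Here a solution is a continuous function $f:\mathbb D\times[0,\infty)\to\mathbb C$, holomorphic in $z$ for each $t$ and differentiable in $t$ for each $z$ (one-sidedly at $t=0$), that satisfies the equation everywhere. (4) For each $k$ and each $t\ge0$ the boundary value $\gamma_k(t)=f(e^{iat}\zeta_k,t)=\lim_{z\to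 e^{iat}\zeta_k,\ z\in\mathbb D}f(z,t)$ exists. The trace $\gamma_k$ is a simple curve, continuous on $[0,\infty)$, with $\gamma_k(0)=\zeta_k$; for $t>0$ it lies in $\mathbb D$ and is $C^\infty$ with $\gamma_k'(t)\ne0$. It leaves $\zeta_k$ perpendicularly to the circle: $$\frac{\gamma_k(t)-\zeta_k}{|\gamma_k(t)-\zeta_k|}\to-\zeta_k\quad\text{and}\quad\frac{\gamma_k'(t)}{|\gamma_k'(t)|}\to-\zeta_k\qquad(t\to0^+).$$ If $a\neq0$, it spirals about the origin: $\gamma_k(t)\ne0$, $|\gamma_k(t)|$ decreases strictly to $0$, and there is a continuous argument $\Theta_k$ of $\gamma_k$ on $[0,\infty)$ which, for all large $t$, is strictly increasing with $\Theta_k(t)\to+\infty$ as $t\to\infty$ if $a>0$, and strictly decreasing with $\Theta_k(t)\to-\infty$ if $a<0$. -/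

import Mathlib

open Set Filter Topology
open scoped ContDiff

namespace RadialLoewner

noncomputable section

/-- The open unit disc. -/
abbrev disc : Set ℂ := Metric.ball (0 : ℂ) 1

/-- The inverse cotangent with values in `(0, π)`. -/
def arccot (x : ℝ) : ℝ := Real.pi / 2 - Real.arctan x

/-- A `ψ`-spirallike domain: a simply connected domain containing the origin and, with each of its
points `w₀`, the logarithmic spiral `w₀ exp(-e^{iψ} t)`, `t ≥ 0`. -/
def IsSpirallikeDomain (ψ : ℝ) (D : Set ℂ) : Prop :=
  ψ ∈ Ioo (-(Real.pi / 2)) (Real.pi / 2) ∧ IsOpen D ∧ IsSimplyConnected D ∧ (0 : ℂ) ∈ D ∧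
    ∀ w ∈ D, ∀ t : ℝ, 0 ≤ t → w * Complex.exp (-Complex.exp (Complex.I * ψ) * t) ∈ D

/-- A `ψ`-spirallike function of the unit disc: holomorphic, univalent, vanishing at the origin,
with `ψ`-spirallike image. -/
def IsSpirallike (ψ : ℝ) (φ : ℂ → ℂ) : Prop :=
  DifferentiableOn ℂ φ disc ∧ InjOn φ disc ∧ φ 0 = 0 ∧ IsSpirallikeDomain ψ (φ '' disc)

variable {n : ℕ}

/-- `R(z) = ∏ₖ (ζₖ - z)`. -/
def R (ζ : Fin n → ℂ) (z : ℂ) : ℂ := ∏ k, (ζ k - z)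

/-- `Q(z) = ∑ₖ bₖ (ζₖ + z) ∏_{j ≠ k} (ζⱼ - z)`. -/
def Q (ζ : Fin n → ℂ) (b : Fin n → ℝ) (z : ℂ) : ℂ :=
  ∑ k, (b k : ℂ) * (ζ k + z) * ∏ j ∈ Finset.univ.erase k, (ζ j - z)

/-- `ξ` lists the `n` roots, with multiplicity, of the polynomial `Q - i a R`, whose leading
coefficient is `(-1)^{n-1} (b + i a)`, `b = ∑ bₖ`. -/
def IsRootList (ζ : Fin n → ℂ) (b : Fin n → ℝ) (a : ℝ) (ξ : Fin n → ℂ) : Prop :=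
  ∀ z : ℂ, Q ζ b z - Complex.I * a * R ζ z =
    (-1) ^ (n - 1) * (((∑ k, b k : ℝ) : ℂ) + Complex.I * a) * ∏ k, (z - ξ k)

/-- The coefficient of `1 / (z - ξₖ)` in the partial fraction decomposition of
`R(z) / (z ∏ⱼ (z - ξⱼ))`. -/
def residue (ζ ξ : Fin n → ℂ) (k : Fin n) : ℂ :=
  R ζ (ξ k) / (ξ k * ∏ j ∈ Finset.univ.erase k, (ξ k - ξ j))

/-- `φ` is, on the unit disc, a holomorphic branch of `z (∏ₖ (z - ξₖ)^{2αₖ})^c`: here `ℓ k` is a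
branch of `log (z - ξₖ)` and `L` a branch of the logarithm of the product. -/
def IsPowerProduct (ξ : Fin n → ℂ) (α : Fin n → ℝ) (c : ℂ) (φ : ℂ → ℂ) : Prop :=
  ∃ (ℓ : Fin n → ℂ → ℂ) (L : ℂ → ℂ),
    (∀ k, DifferentiableOn ℂ (ℓ k) disc ∧ ∀ z ∈ disc, Complex.exp (ℓ k z) = z - ξ k) ∧
    DifferentiableOn ℂ L disc ∧
    (∀ z ∈ disc, Complex.exp (L z) = ∏ k, Complex.exp (2 * (α k : ℂ) * ℓ k z)) ∧
    ∀ z ∈ disc, φ z = z * Complex.exp (c * L z)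

/-- `f` solves, in the disc and for `t ≥ 0`, the radial Loewner–Kufarev equation
`∂ₜ f = - f' z ∑ₖ bₖ (e^{iat} ζₖ + z) / (e^{iat} ζₖ - z)` with `f(z, 0) = z`. -/
def IsSolution (ζ : Fin n → ℂ) (b : Fin n → ℝ) (a : ℝ) (f : ℂ → ℝ → ℂ) : Prop :=
  ContinuousOn (fun p : ℂ × ℝ => f p.1 p.2) (disc ×ˢ Ici 0) ∧
  (∀ t : ℝ, 0 ≤ t → DifferentiableOn ℂ (fun z => f z t) disc) ∧
  (∀ z ∈ disc, f z 0 = z) ∧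
  ∀ z ∈ disc, ∀ t : ℝ, 0 ≤ t →
    HasDerivWithinAt (fun s => f z s)
      (-deriv (fun w => f w t) z * z *
        ∑ k, (b k : ℂ) * ((Complex.exp (Complex.I * a * t) * ζ k + z) /
          (Complex.exp (Complex.I * a * t) * ζ k - z))) (Ici 0) t

/-- `f(z, t) = φ⁻¹(e^{-(β - ia)t} φ(e^{-iat} z))`, with `φ⁻¹` the inverse of `φ` on the disc. -/
def flow (φ : ℂ → ℂ) (β a : ℝ) (z : ℂ) (t : ℝ) : ℂ :=
  Function.invFunOn φ disc
    (Complex.exp (-((β : ℂ) - Complex.I * a) * t) * φ (Complex.exp (-(Complex.I * a * t)) * z))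

/-- `γ(t) = f(e^{iat} ζ, t)` for `t ≥ 0`, in the sense of boundary values from within the disc. -/
def IsTrace (f : ℂ → ℝ → ℂ) (a : ℝ) (ζ : ℂ) (γ : ℝ → ℂ) : Prop :=
  ∀ t : ℝ, 0 ≤ t →
    Tendsto (fun z => f z t) (𝓝[disc] (Complex.exp (Complex.I * a * t) * ζ)) (𝓝 (γ t))

/-- `γ` is continuous for `t ≥ 0`, it starts from `ζ`, it is a simple curve, and for `t > 0` it is
smooth and regular and lies in the disc. -/
def IsSmoothCurveInDiscFrom (ζ : ℂ) (γ : ℝ → ℂ) : Prop :=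
  γ 0 = ζ ∧ ContinuousOn γ (Ici 0) ∧ InjOn γ (Ici 0) ∧ (∀ t : ℝ, 0 < t → γ t ∈ disc) ∧
    ContDiffOn ℝ ∞ γ (Ioi 0) ∧ ∀ t : ℝ, 0 < t → deriv γ t ≠ 0

/-- `γ` leaves the point `ζ` of the unit circle orthogonally: both the direction of the chord from
`ζ` to `γ(t)` and the direction of the velocity tend to the inner normal `-ζ` as `t → 0+`. -/
def StartsPerpendicularly (ζ : ℂ) (γ : ℝ → ℂ) : Prop :=
  Tendsto (fun t => (γ t - ζ) / (‖γ t - ζ‖ : ℂ)) (𝓝[>] 0) (𝓝 (-ζ)) ∧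
    Tendsto (fun t => deriv γ t / (‖deriv γ t‖ : ℂ)) (𝓝[>] 0) (𝓝 (-ζ))

/-- `γ` spirals about the origin, counterclockwise for `a > 0` and clockwise for `a < 0`: the
modulus decreases to `0` and a continuous argument `Θ` is eventually monotone and unbounded. -/
def SpiralsAboutOrigin (a : ℝ) (γ : ℝ → ℂ) : Prop :=
  StrictAntiOn (fun t => ‖γ t‖) (Ici 0) ∧ Tendsto (fun t => ‖γ t‖) atTop (𝓝 0) ∧
    ∃ Θ : ℝ → ℝ, ContinuousOn Θ (Ici 0) ∧
      (∀ t : ℝ, 0 ≤ t → γ t ≠ 0 ∧ γ t = ‖γ t‖ * Complex.exp (Complex.I * Θ t)) ∧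
      (0 < a → Tendsto Θ atTop atTop ∧ ∃ T : ℝ, StrictMonoOn Θ (Ici T)) ∧
      (a < 0 → Tendsto Θ atTop atBot ∧ ∃ T : ℝ, StrictAntiOn Θ (Ici T))

end

end RadialLoewner

/-!
Let `h(z) = ∑ₖ bₖ (ζₖ + z) / (ζₖ - z)` and `p = h - ia`, so that `Q - iaR = R p` and `Re p = Re h >
0` in the disc. In the frame rotating with the measures the Loewner–Kufarev equation is autonomous:
its characteristics are the orbits of `u' = -u p(u)`. A Koenigs function, `φ(z) = z exp (M z)` with
`z p φ' = p(0) φ`, turns these orbits into the spirals `exp (-p(0) t) w`, with `p(0) = b - ia` of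
argument `ψ`.

For every `p` with `Re p > 0` such a `φ` is univalent, since in the coordinate `v = log z` of the
left half-plane the derivative `p(0) / p(exp v)` of `log φ` stays in a half-plane
(`IsKoenigs.injOn`). Its image is invariant under the spirals: the orbit `φ⁻¹ (exp (-p(0) t) φ(u))`
has decreasing modulus, so it cannot leave the disc (`IsKoenigs.exp_mul_mem_image_closedBall`). The
flow solves the equation by differentiation, and every solution is constant along the
characteristics, which stay in the disc when followed back to time `0` (`IsKoenigs.eq_flow`).

The power products are Koenigs functions because of partial fractions. A root of `Q - iaR` is a
point with `h = ia`; since `Re h(z)` is `1 - |z|²` times a positive sum, it lies on the circle,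
where `ξ h'(ξ) < 0`, so it is simple and the residue has the stated argument
(`IsRootList.residue_eq_exponent`). The expansion of `R / (z ∏ₖ (z - ξₖ))` then reads `1 + z M' =
(b - ia) / p` (`IsRootList.one_add_mul`).

At `ζₖ` the function `p` has a simple pole, so `log φ` is analytic there with a critical point:
`log φ(z) - log φ(ζₖ) = -(b - ia) (z - ζₖ)² / (4 bₖ ζₖ²) + ⋯`. Hence `φ(z) = exp (-(b - ia) t)
φ(ζₖ)` has a solution `z = ζₖ (1 - 2 √(bₖ t) + ⋯)`, which enters the disc along the normal
(`exists_arc`). This is the trace for small `t`; by the invariance of the image it continues to all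
`t`, as the preimage under `φ` of a spiral and as an orbit of `u' = -u p(u)`. The two descriptions
give its modulus and argument.
-/

namespace RadialLoewner

/-! ### Koenigs functions -/

/-- `φ` is a Koenigs function of the vector field `-z p(z)`, `Re p > 0`, of the disc: it has the
form `φ(z) = z exp (M z)` with `p (1 + z M') = p(0)`, that is, `z p φ' = p(0) φ`. The logarithm `M` of
`φ(z) / z` is part of the data. -/
structure IsKoenigs (p M φ : ℂ → ℂ) : Prop where
  cont : ContinuousOn p disc
  re_pos : ∀ z ∈ disc, 0 < (p z).re
  diff : DifferentiableOn ℂ M disc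
  eq : ∀ z ∈ disc, p z * (1 + z * deriv M z) = p 0
  phi : ∀ z ∈ disc, φ z = z * Complex.exp (M z)

lemma isOpen_disc : IsOpen disc := Metric.isOpen_ball

lemma mem_disc {z : ℂ} : z ∈ disc ↔ ‖z‖ < 1 := mem_ball_zero_iff

lemma zero_mem_disc : (0 : ℂ) ∈ disc := by simp

lemma disc_mem_nhds {z : ℂ} (hz : z ∈ disc) : disc ∈ 𝓝 z := isOpen_disc.mem_nhds hz

/-- A holomorphic function on a convex set whose derivative stays in a half-plane `Re (c w) > 0`
is injective. -/
lemma injOn_of_re_mul_deriv_pos {s : Set ℂ} (hs : Convex ℝ s) {f f' : ℂ → ℂ}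
    (hf : ∀ z ∈ s, HasDerivAt f (f' z) z) (c : ℂ) (hc : ∀ z ∈ s, 0 < (c * f' z).re) :
    InjOn f s := by
  intro x hx y hy hxy
  by_contra hne
  set d := y - x with hd
  have hd0 : d ≠ 0 := sub_ne_zero.2 (Ne.symm hne)
  have hmem : ∀ t ∈ Icc (0:ℝ) 1, x + t * d ∈ s := by
    intro t ht
    have := hs.add_smul_sub_mem hx hy ht
    simpa [Complex.real_smul] using this
  have hder : ∀ t ∈ Icc (0:ℝ) 1, HasDerivAt (fun t : ℝ => (c * (f (x + t * d) / d)).re)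
      (c * f' (x + t * d)).re t := by
    intro t ht
    have h1 : HasDerivAt (fun w : ℂ => x + w * d) d (t : ℂ) := by
      simpa using ((hasDerivAt_id (t : ℂ)).mul_const d).const_add x
    have h2 := (((hf _ (hmem t ht)).comp (t : ℂ) h1).div_const d).const_mul c
    have h3 := h2.real_of_complex
    rwa [mul_div_cancel_right₀ _ hd0] at h3
  obtain ⟨t, ht, h⟩ := exists_hasDerivAt_eq_slope (fun t : ℝ => (c * (f (x + t * d) / d)).re)
    (fun t => (c * f' (x + t * d)).re) zero_lt_one
    (fun t ht => (hder t ht).continuousAt.continuousWithinAt)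
    (fun t ht => hder t (Ioo_subset_Icc_self ht))
  have hpos := hc _ (hmem t (Ioo_subset_Icc_self ht))
  rw [h] at hpos
  simp [hd, hxy] at hpos

namespace IsKoenigs

variable {p M φ : ℂ → ℂ}

lemma ne_zero (h : IsKoenigs p M φ) {z : ℂ} (hz : z ∈ disc) : p z ≠ 0 := by
  intro h0
  have := h.re_pos z hz
  simp [h0] at this

lemma hasDerivAt_M (h : IsKoenigs p M φ) {z : ℂ} (hz : z ∈ disc) :
    HasDerivAt M (deriv M z) z :=
  (h.diff.differentiableAt (disc_mem_nhds hz)).hasDerivAt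

lemma one_add (h : IsKoenigs p M φ) {z : ℂ} (hz : z ∈ disc) :
    1 + z * deriv M z = p 0 / p z := by
  rw [eq_div_iff (h.ne_zero hz), mul_comm, h.eq z hz]

lemma hasDerivAt (h : IsKoenigs p M φ) {z : ℂ} (hz : z ∈ disc) :
    HasDerivAt φ (Complex.exp (M z) * (p 0 / p z)) z := by
  have h1 : HasDerivAt (fun z => z * Complex.exp (M z))
      (Complex.exp (M z) * (p 0 / p z)) z := by
    refine ((hasDerivAt_id z).mul (h.hasDerivAt_M hz).cexp).congr_deriv ?_
    rw [← h.one_add hz]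
    simp only [id]
    ring
  exact h1.congr_of_eventuallyEq (eventually_of_mem (disc_mem_nhds hz) h.phi)

lemma hasDerivAt_deriv (h : IsKoenigs p M φ) {z : ℂ} (hz : z ∈ disc) :
    HasDerivAt φ (deriv φ z) z := (h.hasDerivAt hz).differentiableAt.hasDerivAt

lemma deriv_ne_zero (h : IsKoenigs p M φ) {z : ℂ} (hz : z ∈ disc) : deriv φ z ≠ 0 := by
  rw [(h.hasDerivAt hz).deriv]
  exact mul_ne_zero (Complex.exp_ne_zero _)
    (div_ne_zero (h.ne_zero zero_mem_disc) (h.ne_zero hz))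

/-- The Koenigs equation `z p(z) φ'(z) = p(0) φ(z)`. -/
lemma koenigs_eq (h : IsKoenigs p M φ) {z : ℂ} (hz : z ∈ disc) :
    z * p z * deriv φ z = p 0 * φ z := by
  rw [(h.hasDerivAt hz).deriv, h.phi z hz]
  have := h.ne_zero hz
  field_simp

lemma differentiableOn (h : IsKoenigs p M φ) : DifferentiableOn ℂ φ disc :=
  fun _ hz => (h.hasDerivAt hz).differentiableAt.differentiableWithinAt

lemma map_zero (h : IsKoenigs p M φ) : φ 0 = 0 := by simp [h.phi 0 zero_mem_disc]

lemma eq_zero_iff (h : IsKoenigs p M φ) {z : ℂ} (hz : z ∈ disc) : φ z = 0 ↔ z = 0 := by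
  simp [h.phi z hz, Complex.exp_ne_zero]

/-- In the coordinate `ω = log z` of the left half-plane, `log φ` has the derivative
`p(0) / p(exp ω)`, whose quotient by `p(0)` has positive real part; so it is injective. -/
lemma injOn (h : IsKoenigs p M φ) : InjOn φ disc := by
  have key : InjOn (fun v => v + M (Complex.exp v)) {v : ℂ | v.re < 0} := by
    have hmem : ∀ v ∈ {v : ℂ | v.re < 0}, Complex.exp v ∈ disc := by
      intro v hv
      rw [mem_disc, Complex.norm_exp]
      simpa using hv
    refine injOn_of_re_mul_deriv_pos (convex_halfSpace_re_lt 0)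
      (f' := fun v => p 0 / p (Complex.exp v)) ?_ (p 0)⁻¹ ?_
    · intro v hv
      refine ((hasDerivAt_id v).add
        ((h.hasDerivAt_M (hmem v hv)).comp v (Complex.hasDerivAt_exp v))).congr_deriv ?_
      rw [← h.one_add (hmem v hv), mul_comm]
    · intro v hv
      have h0 := h.ne_zero zero_mem_disc
      have h1 := h.ne_zero (hmem v hv)
      have : (p 0)⁻¹ * (p 0 / p (Complex.exp v)) = (p (Complex.exp v))⁻¹ := by
        field_simp
      rw [this, Complex.inv_re]
      exact div_pos (h.re_pos _ (hmem v hv)) (Complex.normSq_pos.2 h1)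
  intro z hz w hw hzw
  rcases eq_or_ne z 0 with rfl | hz0
  · rw [h.map_zero, eq_comm, h.eq_zero_iff hw] at hzw
    exact hzw.symm
  rcases eq_or_ne w 0 with rfl | hw0
  · rwa [h.map_zero, h.eq_zero_iff hz] at hzw
  rw [h.phi z hz, h.phi w hw] at hzw
  have hzw' : Complex.exp (Complex.log z + M z) = Complex.exp (Complex.log w + M w) := by
    rwa [Complex.exp_add, Complex.exp_add, Complex.exp_log hz0, Complex.exp_log hw0]
  rw [Complex.exp_eq_exp_iff_exists_int] at hzw'
  obtain ⟨m, hm⟩ := hzw'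
  have hlog : ∀ z : ℂ, z ≠ 0 → z ∈ disc → (Complex.log z).re < 0 := by
    intro z hz0 hz
    rw [Complex.log_re]
    exact Real.log_neg (norm_pos_iff.2 hz0) (mem_disc.1 hz)
  -- `log φ` has the values of `log z` and of a translate of `log w` by a period in common
  have hper : Complex.exp (Complex.log w + m * (2 * Real.pi * Complex.I)) = w := by
    rw [Complex.exp_add, Complex.exp_log hw0, Complex.exp_int_mul_two_pi_mul_I, mul_one]
  have hmem : Complex.log w + m * (2 * Real.pi * Complex.I) ∈ {v : ℂ | v.re < 0} := by
    simpa using hlog w hw0 hw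
  have := key (hlog z hz0 hz) hmem (by
    simp only [hper, Complex.exp_log hz0]
    rw [hm]
    ring)
  rw [← Complex.exp_log hz0, this, hper]

lemma map_nhds (h : IsKoenigs p M φ) {z : ℂ} (hz : z ∈ disc) : map φ (𝓝 z) = 𝓝 (φ z) := by
  have h1 : AnalyticAt ℂ φ z := h.differentiableOn.analyticAt (disc_mem_nhds hz)
  exact h1.hasStrictDerivAt.map_nhds_eq (h.deriv_ne_zero hz)

lemma image_mem_nhds (h : IsKoenigs p M φ) {z : ℂ} (hz : z ∈ disc) : φ '' disc ∈ 𝓝 (φ z) := by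
  rw [← h.map_nhds hz]
  exact image_mem_map (disc_mem_nhds hz)

lemma isOpen_image (h : IsKoenigs p M φ) : IsOpen (φ '' disc) := by
  rw [isOpen_iff_mem_nhds]
  rintro _ ⟨z, hz, rfl⟩
  exact h.image_mem_nhds hz

lemma invFunOn_apply (h : IsKoenigs p M φ) {z : ℂ} (hz : z ∈ disc) :
    Function.invFunOn φ disc (φ z) = z := h.injOn.leftInvOn_invFunOn hz

lemma continuousAt_invFunOn (h : IsKoenigs p M φ) {z : ℂ} (hz : z ∈ disc) :
    ContinuousAt (Function.invFunOn φ disc) (φ z) := by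
  rw [ContinuousAt, ← h.map_nhds hz, tendsto_map'_iff, h.invFunOn_apply hz]
  exact tendsto_id.congr' (eventually_of_mem (disc_mem_nhds hz)
    fun w hw => (h.invFunOn_apply hw).symm)

lemma hasDerivAt_invFunOn (h : IsKoenigs p M φ) {z : ℂ} (hz : z ∈ disc) :
    HasDerivAt (Function.invFunOn φ disc) (deriv φ z)⁻¹ (φ z) := by
  refine HasDerivAt.of_local_left_inverse (f := φ) (h.continuousAt_invFunOn hz) ?_
    (h.deriv_ne_zero hz) ?_
  · rw [h.invFunOn_apply hz]
    exact h.hasDerivAt_deriv hz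
  · exact eventually_of_mem (h.image_mem_nhds hz) fun w hw => Function.invFunOn_eq hw

lemma isSimplyConnected_image (h : IsKoenigs p M φ) : IsSimplyConnected (φ '' disc) := by
  have : ContractibleSpace disc :=
    (convex_ball (0 : ℂ) 1).contractibleSpace ⟨0, zero_mem_disc⟩
  have he : IsOpenEmbedding (disc.domRestrict φ) := by
    refine .of_continuous_injective_isOpenMap h.differentiableOn.continuousOn.domRestrict
      h.injOn.injective (IsOpenMap.of_nhds_le fun z => ?_)
    rw [show disc.domRestrict φ = φ ∘ Subtype.val from rfl, ← map_map,
      map_nhds_subtype_coe_eq_nhds z.2 (disc_mem_nhds z.2), h.map_nhds z.2]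
    rfl
  have h1 := he.isEmbedding.isSimplyConnected_image (s := univ)
  rw [image_univ, range_domRestrict] at h1
  rw [h1]
  have : SimplyConnectedSpace disc := inferInstance
  exact (Homeomorph.Set.univ disc).toHomotopyEquiv.simplyConnectedSpace

end IsKoenigs

/-! ### Spiral invariance of the image -/

/-- A curve satisfying `w' = - w p` at one point, with `Re p > 0` there, moves towards the origin:
its squared modulus has the derivative `-2 |w|² Re p`. -/
lemma hasDerivAt_normSq_of_hasDerivAt {w : ℝ → ℂ} {v q : ℂ} {s : ℝ} (hv : w s = v)
    (hw : HasDerivAt w (-v * q) s) :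
    HasDerivAt (fun s => ‖w s‖ ^ 2) (-(2 * ‖v‖ ^ 2 * q.re)) s := by
  refine hw.norm_sq.congr_deriv ?_
  rw [hv, ← Complex.normSq_eq_norm_sq, Complex.normSq_apply, Complex.inner]
  simp
  ring

lemma eventually_norm_lt_of_hasDerivAt {w : ℝ → ℂ} {v q : ℂ} {s : ℝ} (hv : w s = v)
    (hw : HasDerivAt w (-v * q) s) (hv0 : v ≠ 0) (hq : 0 < q.re) :
    ∀ᶠ x in 𝓝[>] s, ‖w x‖ < ‖v‖ := by
  have h1 := hasDerivAt_normSq_of_hasDerivAt hv hw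
  have hneg : -(2 * ‖v‖ ^ 2 * q.re) < 0 := by
    have := norm_pos_iff.2 hv0
    have : 0 < ‖v‖ ^ 2 * q.re := by positivity
    linarith
  have h2 := (hasDerivAt_iff_tendsto_slope.1 h1).eventually_lt_const hneg
  have h3 : ∀ᶠ x in 𝓝[>] s, slope (fun s => ‖w s‖ ^ 2) s x < 0 :=
    nhdsWithin_mono s (fun x (hx : s < x) => (hx.ne' : x ≠ s)) h2
  filter_upwards [h3, self_mem_nhdsWithin] with x hx hsx
  have hsx' : 0 < x - s := sub_pos.2 hsx
  rw [slope_def_field, div_lt_iff₀ hsx', zero_mul, hv] at hx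
  exact lt_of_pow_lt_pow_left₀ 2 (norm_nonneg _) (by linarith)

namespace IsKoenigs

variable {p M φ : ℂ → ℂ}

/-- Along a curve `w` with `φ (w s) = exp (-p(0) s) A`, the Koenigs equation becomes the
differential equation `w' = - w p(w)`. -/
lemma hasDerivAt_orbit (h : IsKoenigs p M φ) {A v : ℂ} {s : ℝ} (hv : v ∈ disc)
    (hs : φ v = Complex.exp (-p 0 * s) * A) :
    HasDerivAt (fun s : ℝ => Function.invFunOn φ disc (Complex.exp (-p 0 * s) * A))
      (-v * p v) s := by
  have h1 : HasDerivAt (fun s : ℂ => Complex.exp (-p 0 * s) * A)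
      (Complex.exp (-p 0 * s) * (-p 0) * A) s := by
    simpa using (((hasDerivAt_id (s : ℂ)).const_mul (-p 0)).cexp).mul_const A
  have h2 := h.hasDerivAt_invFunOn hv
  rw [hs] at h2
  refine (h2.comp (s : ℂ) h1).comp_ofReal.congr_deriv ?_
  have h3 := h.koenigs_eq hv
  rw [hs] at h3
  rw [inv_mul_eq_iff_eq_mul₀ (h.deriv_ne_zero hv)]
  linear_combination h3

/-- The image of the disc is invariant under `w ↦ exp (-p(0) t) w`, and on the disc this gives a
semigroup of maps that do not increase the modulus. -/
lemma exp_mul_mem_image_closedBall (h : IsKoenigs p M φ) {u : ℂ} (hu : u ∈ disc) {t : ℝ}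
    (ht : 0 ≤ t) :
    Complex.exp (-p 0 * t) * φ u ∈ φ '' Metric.closedBall 0 ‖u‖ := by
  have hsub : Metric.closedBall (0 : ℂ) ‖u‖ ⊆ disc :=
    Metric.closedBall_subset_ball (mem_disc.1 hu)
  rcases eq_or_ne u 0 with rfl | hu0
  · exact ⟨0, by simp, by simp [h.map_zero]⟩
  have hc : IsClosed (φ '' Metric.closedBall 0 ‖u‖) :=
    ((isCompact_closedBall (0 : ℂ) ‖u‖).image_of_continuousOn
      (h.differentiableOn.continuousOn.mono hsub)).isClosed
  have hcont : Continuous fun s : ℝ => Complex.exp (-p 0 * s) * φ u := by fun_prop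
  have key : Icc 0 t ⊆ (fun s : ℝ => Complex.exp (-p 0 * s) * φ u) ⁻¹'
      (φ '' Metric.closedBall 0 ‖u‖) := by
    refine IsClosed.Icc_subset_of_forall_exists_gt ((hc.preimage hcont).inter isClosed_Icc)
      ⟨u, by simp, by simp⟩ ?_
    -- as long as it exists, the orbit has decreasing modulus, so it extends beyond `s` in the ball
    rintro s ⟨⟨v, hvu, hv⟩, -⟩ y (hy : s < y)
    replace hv : φ v = Complex.exp (-p 0 * s) * φ u := hv
    have hvd := hsub hvu
    have hvs : Function.invFunOn φ disc (Complex.exp (-p 0 * s) * φ u) = v := by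
      rw [← hv, h.invFunOn_apply hvd]
    have hv0 : v ≠ 0 := by
      rintro rfl
      rw [h.map_zero, eq_comm, mul_eq_zero, h.eq_zero_iff hu] at hv
      exact hv.elim (Complex.exp_ne_zero _) hu0
    have hd := h.hasDerivAt_orbit hvd hv
    have h1 := eventually_norm_lt_of_hasDerivAt hvs hd hv0 (h.re_pos v hvd)
    have h2 : ∀ᶠ x : ℝ in 𝓝[>] s, Complex.exp (-p 0 * x) * φ u ∈ φ '' disc := by
      refine (hcont.tendsto s).mono_left nhdsWithin_le_nhds ?_
      rw [← hv]
      exact h.image_mem_nhds hvd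
    obtain ⟨x, ⟨hx1, hx2⟩, hx3⟩ := ((h1.and h2).and (Ioc_mem_nhdsGT hy)).exists
    refine ⟨x, ⟨_, ?_, Function.invFunOn_eq hx2⟩, hx3⟩
    rw [mem_closedBall_zero_iff] at hvu ⊢
    exact hx1.le.trans hvu
  exact key ⟨ht, le_rfl⟩

lemma exp_mul_mem_image (h : IsKoenigs p M φ) {w : ℂ} (hw : w ∈ φ '' disc) {t : ℝ}
    (ht : 0 ≤ t) : Complex.exp (-p 0 * t) * w ∈ φ '' disc := by
  obtain ⟨u, hu, rfl⟩ := hw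
  exact image_mono (Metric.closedBall_subset_ball (mem_disc.1 hu))
    (h.exp_mul_mem_image_closedBall hu ht)

lemma isSpirallike (h : IsKoenigs p M φ) {ψ : ℝ} (hψ : ψ ∈ Ioo (-(Real.pi / 2)) (Real.pi / 2))
    (hp : p 0 = ‖p 0‖ * Complex.exp (Complex.I * ψ)) : IsSpirallike ψ φ := by
  refine ⟨h.differentiableOn, h.injOn, h.map_zero, hψ, h.isOpen_image,
    h.isSimplyConnected_image, ⟨0, zero_mem_disc, h.map_zero⟩, fun w hw t ht => ?_⟩
  have hpos : 0 < ‖p 0‖ := norm_pos_iff.2 (h.ne_zero zero_mem_disc)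
  have := h.exp_mul_mem_image hw (t := t / ‖p 0‖) (by positivity)
  convert this using 1
  rw [mul_comm]
  congr 2
  push_cast
  have h0 : (‖p 0‖ : ℂ) ≠ 0 := by exact_mod_cast hpos.ne'
  field_simp
  linear_combination (t : ℂ) * hp

end IsKoenigs

/-! ### The flow and the transport equation -/

namespace IsKoenigs

variable {p M φ : ℂ → ℂ} {β a : ℝ}

lemma exp_mul_mem_disc {z : ℂ} (hz : z ∈ disc) (x : ℝ) :
    Complex.exp (-(Complex.I * a * x)) * z ∈ disc := by
  rw [mem_disc, norm_mul, Complex.norm_exp]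
  simpa using hz

lemma flow_arg_mem (h : IsKoenigs p M φ) (hp : p 0 = β - Complex.I * a) {z : ℂ} (hz : z ∈ disc)
    {t : ℝ} (ht : 0 ≤ t) :
    Complex.exp (-((β : ℂ) - Complex.I * a) * t) * φ (Complex.exp (-(Complex.I * a * t)) * z)
      ∈ φ '' disc := by
  rw [← hp]
  exact h.exp_mul_mem_image ⟨_, exp_mul_mem_disc hz t, rfl⟩ ht

lemma flow_mem (h : IsKoenigs p M φ) (hp : p 0 = β - Complex.I * a) {z : ℂ} (hz : z ∈ disc)
    {t : ℝ} (ht : 0 ≤ t) : flow φ β a z t ∈ disc :=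
  Function.invFunOn_mem (h.flow_arg_mem hp hz ht)

lemma map_flow (h : IsKoenigs p M φ) (hp : p 0 = β - Complex.I * a) {z : ℂ} (hz : z ∈ disc)
    {t : ℝ} (ht : 0 ≤ t) :
    φ (flow φ β a z t) = Complex.exp (-((β : ℂ) - Complex.I * a) * t) *
      φ (Complex.exp (-(Complex.I * a * t)) * z) :=
  Function.invFunOn_eq (h.flow_arg_mem hp hz ht)

lemma continuousOn_invFunOn (h : IsKoenigs p M φ) :
    ContinuousOn (Function.invFunOn φ disc) (φ '' disc) := by
  rintro _ ⟨z, hz, rfl⟩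
  exact (h.continuousAt_invFunOn hz).continuousWithinAt

lemma continuousOn_flow (h : IsKoenigs p M φ) (hp : p 0 = β - Complex.I * a) :
    ContinuousOn (fun q : ℂ × ℝ => flow φ β a q.1 q.2) (disc ×ˢ Ici 0) := by
  refine h.continuousOn_invFunOn.comp (ContinuousOn.mul (by fun_prop) ?_)
    fun q hq => h.flow_arg_mem hp hq.1 hq.2
  exact h.differentiableOn.continuousOn.comp (by fun_prop) fun q hq => exp_mul_mem_disc hq.1 _

lemma flow_zero (h : IsKoenigs p M φ) {z : ℂ} (hz : z ∈ disc) : flow φ β a z 0 = z := by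
  simp [flow, h.invFunOn_apply hz]

lemma hasDerivAt_flow_fst (h : IsKoenigs p M φ) (hp : p 0 = β - Complex.I * a) {z : ℂ}
    (hz : z ∈ disc) {t : ℝ} (ht : 0 ≤ t) :
    HasDerivAt (fun z => flow φ β a z t) ((deriv φ (flow φ β a z t))⁻¹ *
      (Complex.exp (-((β : ℂ) - Complex.I * a) * t) *
        (deriv φ (Complex.exp (-(Complex.I * a * t)) * z) *
          Complex.exp (-(Complex.I * a * t))))) z := by
  have h1 := h.hasDerivAt_invFunOn (h.flow_mem hp hz ht)
  rw [h.map_flow hp hz ht] at h1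
  have h2 : HasDerivAt (fun z => Complex.exp (-(Complex.I * a * t)) * z)
      (Complex.exp (-(Complex.I * a * t))) z := by
    simpa using (hasDerivAt_id z).const_mul (Complex.exp (-(Complex.I * a * t)))
  have h3 := ((h.hasDerivAt_deriv (exp_mul_mem_disc hz t)).comp z h2).const_mul
    (Complex.exp (-((β : ℂ) - Complex.I * a) * t))
  exact h1.comp z h3

lemma hasDerivAt_flow_snd (h : IsKoenigs p M φ) (hp : p 0 = β - Complex.I * a) {z : ℂ}
    (hz : z ∈ disc) {t : ℝ} (ht : 0 ≤ t) :
    HasDerivAt (fun t => flow φ β a z t) (-deriv (fun z => flow φ β a z t) z * z *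
      (p (Complex.exp (-(Complex.I * a * t)) * z) + Complex.I * a)) t := by
  have h1 := h.hasDerivAt_invFunOn (h.flow_mem hp hz ht)
  rw [h.map_flow hp hz ht] at h1
  have h2 : HasDerivAt (fun t : ℂ => Complex.exp (-(Complex.I * a * t)) * z)
      (Complex.exp (-(Complex.I * a * t)) * (-(Complex.I * a)) * z) t := by
    simpa using (((hasDerivAt_id (t : ℂ)).const_mul (Complex.I * a)).fun_neg.cexp).mul_const z
  have h3 : HasDerivAt (fun t : ℂ => Complex.exp (-((β : ℂ) - Complex.I * a) * t))
      (Complex.exp (-((β : ℂ) - Complex.I * a) * t) * (-((β : ℂ) - Complex.I * a))) t := by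
    simpa using ((hasDerivAt_id (t : ℂ)).const_mul (-((β : ℂ) - Complex.I * a))).cexp
  have hu := exp_mul_mem_disc (a := a) hz t
  have h4 := h1.comp (t : ℂ) (h3.mul ((h.hasDerivAt_deriv hu).comp (t : ℂ) h2))
  refine h4.comp_ofReal.congr_deriv ?_
  rw [(h.hasDerivAt_flow_fst hp hz ht).deriv]
  have h5 := h.koenigs_eq hu
  rw [hp] at h5
  simp only [Function.comp]
  linear_combination (-(deriv φ (flow φ β a z t))⁻¹ *
    Complex.exp (-((β : ℂ) - Complex.I * a) * t)) * (-h5)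

end IsKoenigs

/-- A function that is jointly continuous and holomorphic in the first variable has a jointly
continuous derivative in that variable, by the Cauchy estimates. -/
lemma continuousAt_deriv_fst {U : Set ℂ} (hU : IsOpen U) {I : Set ℝ} {g : ℂ → ℝ → ℂ}
    (hg : ContinuousOn (fun q : ℂ × ℝ => g q.1 q.2) (U ×ˢ I))
    (hd : ∀ t ∈ I, DifferentiableOn ℂ (fun z => g z t) U) {z : ℂ} {t : ℝ} (hz : z ∈ U)
    (ht : I ∈ 𝓝 t) :
    ContinuousAt (fun q : ℂ × ℝ => deriv (fun w => g w q.2) q.1) (z, t) := by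
  have htI := mem_of_mem_nhds ht
  have h1 : TendstoLocallyUniformlyOn (fun (q : ℂ × ℝ) w => g w q.2) (fun w => g w t)
      (𝓝 (z, t)) U := by
    rw [Metric.tendstoLocallyUniformlyOn_iff]
    intro ε hε x hx
    have hc : ContinuousAt (fun q : ℂ × ℝ => g q.1 q.2) (x, t) :=
      hg.continuousAt (prod_mem_nhds (hU.mem_nhds hx) ht)
    have h2 := Metric.continuousAt_iff'.1 hc (ε / 2) (half_pos hε)
    rw [nhds_prod_eq, eventually_prod_iff] at h2
    obtain ⟨P, hP, S, hS, hPS⟩ := h2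
    refine ⟨{y | P y}, mem_nhdsWithin_of_mem_nhds hP, ?_⟩
    filter_upwards [(continuous_snd.tendsto (z, t)) hS] with q hq y hy
    have h3 := hPS (x := y) hy (y := q.2) hq
    have h4 := hPS (x := y) hy (y := t) hS.self_of_nhds
    calc _ ≤ dist (g y t) (g x t) + dist (g y q.2) (g x t) := dist_triangle_right _ _ _
      _ < ε := by simp only at h3 h4; linarith
  have hev : ∀ᶠ q : ℂ × ℝ in 𝓝 (z, t), DifferentiableOn ℂ (fun w => g w q.2) U := by
    filter_upwards [(continuous_snd.tendsto (z, t)) ht] with q hq using hd _ hq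
  have h2 := h1.deriv hev hU
  have hcd : ContinuousAt (deriv fun w => g w t) z :=
    ((hd t htI).deriv hU).continuousOn.continuousAt (hU.mem_nhds hz)
  refine tendsto_comp_of_locally_uniform_limit hcd (continuous_fst.tendsto (z, t)) ?_
  intro u hu
  obtain ⟨V, hV, h3⟩ := h2 u hu z hz
  exact ⟨V, by rwa [hU.nhdsWithin_eq hz] at hV, h3⟩

/-- Solutions of a transport equation are constant along the characteristics. -/
lemma hasDerivAt_comp_of_transport {U : Set ℂ} (hU : IsOpen U) {I : Set ℝ} (hI : IsOpen I)
    {g : ℂ → ℝ → ℂ} {V : ℂ → ℝ → ℂ}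
    (hg : ContinuousOn (fun q : ℂ × ℝ => g q.1 q.2) (U ×ˢ I))
    (hV : ContinuousOn (fun q : ℂ × ℝ => V q.1 q.2) (U ×ˢ I))
    (hd : ∀ t ∈ I, DifferentiableOn ℂ (fun z => g z t) U)
    (heq : ∀ z ∈ U, ∀ t ∈ I,
      HasDerivAt (fun s => g z s) (-deriv (fun w => g w t) z * V z t) t)
    {y : ℝ → ℂ} {τ : ℝ → ℝ} {s : ℝ} {σ : ℝ} (hy : y s ∈ U) (hs : τ s ∈ I)
    (hτ : HasDerivAt τ σ s) (hyd : HasDerivAt y (σ * V (y s) (τ s)) s) :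
    HasDerivAt (fun s => g (y s) (τ s)) 0 s := by
  have hmem : U ×ˢ I ∈ 𝓝 (y s, τ s) := prod_mem_nhds (hU.mem_nhds hy) (hI.mem_nhds hs)
  have hc1 := continuousAt_deriv_fst hU hg hd hy (hI.mem_nhds hs)
  have hcV := hV.continuousAt hmem
  have key := hasStrictFDerivAt_uncurry_coprod (𝕜 := ℝ) (u := (y s, τ s)) (f := g)
    (f₁ := fun z t => deriv (fun w => g w t) z • (1 : ℂ →L[ℝ] ℂ))
    (f₂ := fun z t => (ContinuousLinearMap.smulRight (1 : ℝ →L[ℝ] ℝ)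
      (-deriv (fun w => g w t) z * V z t)))
    (by
      filter_upwards [hmem] with q hq
      exact ((hd q.2 hq.2).differentiableAt
        (hU.mem_nhds hq.1)).hasDerivAt.complexToReal_fderiv)
    (by
      filter_upwards [hmem] with q hq
      exact (heq q.1 hq.1 q.2 hq.2).hasFDerivAt)
    (hc1.smul continuousAt_const)
    (by
      have := (ContinuousLinearMap.smulRightL ℝ ℝ ℂ (1 : ℝ →L[ℝ] ℝ)).continuous.continuousAt.comp
        (hc1.neg.mul hcV)
      exact this)
  have h2 := key.hasFDerivAt.comp_hasDerivAt s (hyd.prodMk hτ)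
  refine h2.congr_deriv ?_
  simp [Function.HasUncurry.uncurry]
  ring

namespace IsKoenigs

variable {p M φ : ℂ → ℂ} {β a : ℝ}

/-- The characteristics of the equation are `τ ↦ exp (ia (t - τ)) u(τ)`, where `u` is the orbit of
the semigroup through `exp (-iat) z`; backwards in time they stay in the disc. -/
lemma eq_flow (h : IsKoenigs p M φ) (hp : p 0 = β - Complex.I * a) {g : ℂ → ℝ → ℂ}
    (hg : ContinuousOn (fun q : ℂ × ℝ => g q.1 q.2) (disc ×ˢ Ici 0))
    (hd : ∀ t : ℝ, 0 ≤ t → DifferentiableOn ℂ (fun z => g z t) disc)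
    (h0 : ∀ z ∈ disc, g z 0 = z)
    (heq : ∀ z ∈ disc, ∀ t : ℝ, 0 ≤ t → HasDerivWithinAt (fun s => g z s)
      (-deriv (fun w => g w t) z * z *
        (p (Complex.exp (-(Complex.I * a * t)) * z) + Complex.I * a)) (Ici 0) t)
    {z : ℂ} (hz : z ∈ disc) {t : ℝ} (ht : 0 ≤ t) : g z t = flow φ β a z t := by
  set u := Complex.exp (-(Complex.I * a * t)) * z with hu
  have hud : u ∈ disc := exp_mul_mem_disc hz t
  set v : ℝ → ℂ := fun τ => Function.invFunOn φ disc (Complex.exp (-p 0 * τ) * φ u) with hv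
  have hvd : ∀ τ : ℝ, 0 ≤ τ → v τ ∈ disc := fun τ hτ =>
    Function.invFunOn_mem (h.exp_mul_mem_image ⟨u, hud, rfl⟩ hτ)
  have hvφ : ∀ τ : ℝ, 0 ≤ τ → φ (v τ) = Complex.exp (-p 0 * τ) * φ u := fun τ hτ =>
    Function.invFunOn_eq (h.exp_mul_mem_image ⟨u, hud, rfl⟩ hτ)
  set y : ℝ → ℂ := fun τ => Complex.exp (Complex.I * a * (t - τ)) * v τ with hy
  have hvder : ∀ τ : ℝ, 0 ≤ τ → HasDerivAt v (-v τ * p (v τ)) τ := fun τ hτ =>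
    h.hasDerivAt_orbit (hvd τ hτ) (hvφ τ hτ)
  have hyd : ∀ τ : ℝ, 0 ≤ τ → y τ ∈ disc := by
    intro τ hτ
    have := exp_mul_mem_disc (a := -a) (hvd τ hτ) (t - τ)
    simpa [hy] using this
  have hyv : ∀ τ : ℝ, Complex.exp (-(Complex.I * a * (t - τ : ℝ))) * y τ = v τ := by
    intro τ
    simp only [hy]
    rw [← mul_assoc, ← Complex.exp_add]
    simp
  have hyder : ∀ τ : ℝ, 0 ≤ τ → HasDerivAt y
      (((-1 : ℝ) : ℂ) * (y τ * (p (Complex.exp (-(Complex.I * a * (t - τ : ℝ))) * y τ) +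
        Complex.I * a))) τ := by
    intro τ hτ
    rw [hyv]
    have h1 : HasDerivAt (fun x : ℂ => Complex.exp (Complex.I * a * (t - x)))
        (Complex.exp (Complex.I * a * (t - τ)) * (Complex.I * a * (-1))) τ :=
      (((hasDerivAt_id (τ : ℂ)).const_sub (t : ℂ)).const_mul (Complex.I * a)).cexp
    refine (h1.comp_ofReal.mul (hvder τ hτ)).congr_deriv ?_
    simp only [hy]
    push_cast
    ring
  have hpc : ContinuousOn (fun q : ℂ × ℝ => q.1 *
      (p (Complex.exp (-(Complex.I * a * q.2)) * q.1) + Complex.I * a)) (disc ×ˢ Ioi 0) := by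
    refine continuousOn_fst.mul (ContinuousOn.add ?_ continuousOn_const)
    exact h.cont.comp (by fun_prop) fun q hq => exp_mul_mem_disc hq.1 _
  have hcont : ContinuousOn (fun τ => g (y τ) (t - τ)) (Icc 0 t) := by
    refine hg.comp (f := fun τ => (y τ, t - τ)) (ContinuousOn.prodMk ?_ (by fun_prop)) ?_
    · exact fun τ hτ => (hyder τ hτ.1).continuousAt.continuousWithinAt
    · exact fun τ hτ => ⟨hyd τ hτ.1, sub_nonneg.2 hτ.2⟩
  -- time runs backwards, so that the equation is only needed at the positive times `t - τ`
  have hconst := constant_of_has_deriv_right_zero hcont (fun τ hτ => by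
    refine (hasDerivAt_comp_of_transport isOpen_disc isOpen_Ioi
      (V := fun z t => z * (p (Complex.exp (-(Complex.I * a * t)) * z) + Complex.I * a))
      (hg.mono (prod_mono_right Ioi_subset_Ici_self)) hpc
      (fun s hs => hd s (le_of_lt hs)) ?_ (hyd τ hτ.1) (τ := fun τ => t - τ) (σ := -1)
      (sub_pos.2 hτ.2 : 0 < t - τ) ((hasDerivAt_id τ).const_sub t)
      (hyder τ hτ.1)).hasDerivWithinAt
    intro z hz s hs
    rw [← mul_assoc]
    exact (heq z hz s (le_of_lt hs)).hasDerivAt (Ici_mem_nhds hs)) t ⟨ht, le_rfl⟩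
  have hy0 : y 0 = z := by
    have : v 0 = u := by simp [hv, h.invFunOn_apply hud]
    simp only [hy, this, hu]
    rw [← mul_assoc, ← Complex.exp_add]
    simp
  have hyt : y t = flow φ β a z t := by
    simp only [hy, hv, sub_self, flow, hp, hu]
    simp
  simp only [sub_self, sub_zero, hy0] at hconst
  rw [← hconst, h0 _ (hyd t ht), hyt]

end IsKoenigs

/-! ### The polynomial `Q - iaR` and partial fractions -/

section Polynomials

open Polynomial

lemma natDegree_prod_le_card {ι : Type*} (s : Finset ι) (f : ι → ℂ[X])
    (hf : ∀ j ∈ s, (f j).natDegree ≤ 1) : (∏ j ∈ s, f j).natDegree ≤ s.card := by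
  refine (natDegree_prod_le s f).trans ((Finset.sum_le_card_nsmul s _ 1 hf).trans ?_)
  simp

lemma coeff_prod_card {ι : Type*} (s : Finset ι) (f : ι → ℂ[X]) (d : ℂ)
    (hf : ∀ j ∈ s, (f j).natDegree ≤ 1) (hd : ∀ j ∈ s, (f j).coeff 1 = d) :
    (∏ j ∈ s, f j).coeff s.card = d ^ s.card := by
  have h := coeff_prod_of_natDegree_le s f 1 hf
  rw [mul_one] at h
  rw [h, Finset.prod_congr rfl hd, Finset.prod_const]

lemma natDegree_C_sub_X_le (c : ℂ) : (C c - X).natDegree ≤ 1 := by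
  compute_degree

lemma coeff_one_C_sub_X (c : ℂ) : (C c - X).coeff 1 = -1 := by
  simp

lemma coeff_one_X_sub_C (c : ℂ) : (X - C c).coeff 1 = 1 := by
  simp

variable {n : ℕ}

lemma card_univ_erase (k : Fin n) : (Finset.univ.erase k).card = n - 1 := by
  simp [Finset.card_erase_of_mem]

/-- The fundamental theorem of algebra for a polynomial function given by its degree bound and its
top coefficient. -/
lemma exists_eval_eq_mul_prod (P : ℂ[X]) (hdeg : P.natDegree ≤ n) (hlead : P.coeff n ≠ 0) :
    ∃ ξ : Fin n → ℂ, ∀ z, P.eval z = P.coeff n * ∏ k, (z - ξ k) := by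
  have hn : P.natDegree = n := natDegree_eq_of_le_of_coeff_ne_zero hdeg hlead
  have hs := IsAlgClosed.splits P
  have hcard : P.roots.toList.length = n := by
    rw [Multiset.length_toList, ← hn]
    exact hs.natDegree_eq_card_roots.symm
  refine ⟨fun k => P.roots.toList.get (k.cast hcard.symm), fun z => ?_⟩
  have h1 := hs.eval_eq_prod_roots z
  rw [h1, leadingCoeff, hn]
  congr 1
  have h2 : ∏ k : Fin n, (z - P.roots.toList.get (k.cast hcard.symm)) =
      ∏ k : Fin P.roots.toList.length, (z - P.roots.toList.get k) :=
    Fintype.prod_equiv (finCongr hcard.symm) _ _ fun k => rfl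
  rw [h2]
  conv_lhs => rw [← Multiset.coe_toList P.roots]
  rw [Multiset.map_coe, Multiset.prod_coe, ← List.prod_ofFn]
  congr 1
  conv_lhs => rw [← List.ofFn_get P.roots.toList]
  rw [List.map_ofFn]
  rfl

/-- `Q - iaR` has degree `n` with the leading coefficient `(-1)^{n-1} (b + ia)`. -/
lemma exists_isRootList (hn : 1 ≤ n) (ζ : Fin n → ℂ) (b : Fin n → ℝ) (hb : 0 < ∑ k, b k) (a : ℝ) :
    ∃ ξ : Fin n → ℂ, IsRootList ζ b a ξ := by
  set P : ℂ[X] := ∑ k, C (b k : ℂ) * ((C (ζ k) + X) * ∏ j ∈ Finset.univ.erase k, (C (ζ j) - X)) -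
    C (Complex.I * a) * ∏ k, (C (ζ k) - X) with hP
  have hdR : (∏ k, (C (ζ k) - X)).natDegree ≤ n := by
    simpa using natDegree_prod_le_card Finset.univ (fun k => C (ζ k) - X)
      fun k _ => natDegree_C_sub_X_le _
  have hcR : (∏ k, (C (ζ k) - X)).coeff n = (-1) ^ n := by
    simpa using coeff_prod_card Finset.univ (fun k => C (ζ k) - X) (-1)
      (fun k _ => natDegree_C_sub_X_le _) (fun k _ => coeff_one_C_sub_X _)
  have hdE : ∀ k, (∏ j ∈ Finset.univ.erase k, (C (ζ j) - X)).natDegree ≤ n - 1 := fun k => by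
    simpa only [card_univ_erase] using natDegree_prod_le_card (Finset.univ.erase k)
      (fun k => C (ζ k) - X) fun k _ => natDegree_C_sub_X_le _
  have hcE : ∀ k, (∏ j ∈ Finset.univ.erase k, (C (ζ j) - X)).coeff (n - 1) = (-1) ^ (n - 1) :=
    fun k => by
      simpa only [card_univ_erase] using coeff_prod_card (Finset.univ.erase k)
        (fun k => C (ζ k) - X) (-1)
        (fun k _ => natDegree_C_sub_X_le _) (fun k _ => coeff_one_C_sub_X _)
  have hL : ∀ k, (C (ζ k) + X).natDegree ≤ 1 := fun k => by compute_degree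
  have hn1 : 1 + (n - 1) = n := by omega
  have hdeg : P.natDegree ≤ n := by
    refine natDegree_sub_le_of_le (m := n) (natDegree_sum_le_of_forall_le _ _ fun k _ => ?_)
      ((natDegree_C_mul_le _ _).trans hdR) |>.trans (max_self n).le
    refine (natDegree_C_mul_le _ _).trans (natDegree_mul_le.trans ?_)
    have := hL k
    have := hdE k
    omega
  have hlead : P.coeff n = (-1) ^ (n - 1) * (((∑ k, b k : ℝ) : ℂ) + Complex.I * a) := by
    have h1 : ∀ k, ((C (ζ k) + X) * ∏ j ∈ Finset.univ.erase k, (C (ζ j) - X)).coeff n =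
        (-1) ^ (n - 1) := by
      intro k
      have h2 := coeff_mul_add_eq_of_natDegree_le (hL k) (hdE k)
      rw [hn1, hcE] at h2
      rw [h2]
      simp
    have h3 : ((-1 : ℂ)) ^ n = (-1) ^ (n - 1) * (-1) := by
      rw [← pow_succ, Nat.sub_add_cancel hn]
    simp only [hP, coeff_sub, finsetSum_coeff, coeff_C_mul, h1, hcR, h3]
    rw [← Finset.sum_mul]
    push_cast
    ring
  have hne : P.coeff n ≠ 0 := by
    rw [hlead]
    refine mul_ne_zero (by simp) fun h => ?_
    have := congrArg Complex.re h
    simp at this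
    rw [this] at hb
    exact lt_irrefl _ hb
  obtain ⟨ξ, hξ⟩ := exists_eval_eq_mul_prod P hdeg hne
  refine ⟨ξ, fun z => ?_⟩
  rw [← hlead, ← hξ z]
  simp only [hP, Q, R, eval_sub, eval_finsetSum, eval_mul, eval_C, eval_add, eval_X, eval_prod,
    mul_assoc]

/-- Partial fractions of `R(z) / (z ∏ⱼ (z - ξⱼ))`, with the denominators cleared, together with the
comparison of the coefficients of `z ^ n`. -/
lemma partial_fractions (hn : 1 ≤ n) (ζ ξ : Fin n → ℂ) (hinj : Function.Injective ξ)
    (h0 : ∀ k, ξ k ≠ 0) (A : ℂ) (hA : R ζ 0 = A * ∏ k, (0 - ξ k)) :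
    (∀ z, R ζ z = A * ∏ k, (z - ξ k) +
      z * ∑ k, residue ζ ξ k * ∏ j ∈ Finset.univ.erase k, (z - ξ j)) ∧
    (-1) ^ n = A + ∑ k, residue ζ ξ k := by
  set D : ℂ[X] := ∏ k, (C (ζ k) - X) - (C A * ∏ k, (X - C (ξ k)) +
    X * ∑ k, C (residue ζ ξ k) * ∏ j ∈ Finset.univ.erase k, (X - C (ξ j))) with hD
  have hdR : (∏ k, (C (ζ k) - X)).natDegree ≤ n := by
    simpa using natDegree_prod_le_card Finset.univ (fun k => C (ζ k) - X)
      fun k _ => natDegree_C_sub_X_le _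
  have hcR : (∏ k, (C (ζ k) - X)).coeff n = (-1) ^ n := by
    simpa using coeff_prod_card Finset.univ (fun k => C (ζ k) - X) (-1)
      (fun k _ => natDegree_C_sub_X_le _) (fun k _ => coeff_one_C_sub_X _)
  have hdX : (∏ k, (X - C (ξ k))).natDegree ≤ n := by
    simpa only [Finset.card_univ, Fintype.card_fin] using
      natDegree_prod_le_card Finset.univ (fun k => X - C (ξ k)) fun k _ => natDegree_X_sub_C_le _
  have hcX : (∏ k, (X - C (ξ k))).coeff n = 1 := by
    simpa using coeff_prod_card Finset.univ (fun k => X - C (ξ k)) 1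
      (fun k _ => natDegree_X_sub_C_le _) (fun k _ => coeff_one_X_sub_C _)
  have hdE : ∀ k, (∏ j ∈ Finset.univ.erase k, (X - C (ξ j))).natDegree ≤ n - 1 := fun k => by
    simpa only [card_univ_erase] using natDegree_prod_le_card (Finset.univ.erase k)
      (fun k => X - C (ξ k)) fun k _ => natDegree_X_sub_C_le _
  have hcE : ∀ k, (∏ j ∈ Finset.univ.erase k, (X - C (ξ j))).coeff (n - 1) = 1 := fun k => by
    simpa only [card_univ_erase, one_pow] using coeff_prod_card (Finset.univ.erase k)
      (fun k => X - C (ξ k)) 1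
      (fun k _ => natDegree_X_sub_C_le _) (fun k _ => coeff_one_X_sub_C _)
  have hdS : (∑ k, C (residue ζ ξ k) *
      ∏ j ∈ Finset.univ.erase k, (X - C (ξ j))).natDegree ≤ n - 1 :=
    natDegree_sum_le_of_forall_le _ _ fun k _ => (natDegree_C_mul_le _ _).trans (hdE k)
  have hdeg : D.natDegree ≤ n := by
    refine natDegree_sub_le_of_le hdR (natDegree_add_le_of_degree_le
      ((natDegree_C_mul_le _ _).trans hdX) (natDegree_mul_le.trans ?_)) |>.trans (max_self n).le
    rw [natDegree_X]
    omega
  have hev : ∀ z, D.eval z = R ζ z - (A * ∏ k, (z - ξ k) +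
      z * ∑ k, residue ζ ξ k * ∏ j ∈ Finset.univ.erase k, (z - ξ j)) := by
    intro z
    simp only [hD, R, eval_sub, eval_finsetSum, eval_mul, eval_C, eval_add, eval_X, eval_prod]
  have hroot : ∀ k, D.eval (ξ k) = 0 := by
    intro k
    have hk : ∏ j ∈ Finset.univ.erase k, (ξ k - ξ j) ≠ 0 :=
      Finset.prod_ne_zero_iff.2 fun j hj =>
        sub_ne_zero.2 fun h => (Finset.ne_of_mem_erase hj) (hinj h).symm
    rw [hev, Finset.prod_eq_zero (Finset.mem_univ k) (sub_self _),
      Finset.sum_eq_single k (fun j _ hj => by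
        rw [Finset.prod_eq_zero (Finset.mem_erase.2 ⟨hj.symm, Finset.mem_univ k⟩) (sub_self _),
          mul_zero]) (by simp), residue]
    have := h0 k
    field_simp
    ring
  -- `D` has degree at most `n` and the `n + 1` roots `0, ξ₁, …, ξₙ`
  have hD0 : D = 0 := by
    refine eq_zero_of_natDegree_lt_card_of_eval_eq_zero' D (insert 0 (Finset.univ.image ξ)) ?_ ?_
    · intro x hx
      rcases Finset.mem_insert.1 hx with rfl | hx
      · rw [hev, hA]
        ring
      · obtain ⟨k, -, rfl⟩ := Finset.mem_image.1 hx
        exact hroot k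
    · rw [Finset.card_insert_of_notMem (by simpa using h0),
        Finset.card_image_of_injective _ hinj, Finset.card_univ, Fintype.card_fin]
      omega
  refine ⟨fun z => ?_, ?_⟩
  · have := hev z
    rw [hD0, eval_zero] at this
    exact sub_eq_zero.1 this.symm
  · have h1 : D.coeff n = (-1) ^ n - (A * 1 + ∑ k, residue ζ ξ k) := by
      obtain ⟨m, rfl⟩ : ∃ m, n = m + 1 := ⟨n - 1, by omega⟩
      simp only [Nat.add_sub_cancel] at hcE
      simp only [hD, coeff_sub, coeff_add, coeff_C_mul, coeff_X_mul, finsetSum_coeff, hcR, hcX,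
        hcE, mul_one]
    rw [hD0, coeff_zero, mul_one] at h1
    exact sub_eq_zero.1 h1.symm

end Polynomials

/-! ### The roots and the residues -/

section Roots

variable {n : ℕ} {ζ ξ : Fin n → ℂ} {b : Fin n → ℝ} {a : ℝ}

/-- The Herglotz function `∑ₖ bₖ (ζₖ + z) / (ζₖ - z)`. -/
noncomputable def herglotz (ζ : Fin n → ℂ) (b : Fin n → ℝ) (z : ℂ) : ℂ :=
  ∑ k, (b k : ℂ) * ((ζ k + z) / (ζ k - z))

lemma R_ne_zero {z : ℂ} (hz : ∀ k, ζ k - z ≠ 0) : R ζ z ≠ 0 :=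
  Finset.prod_ne_zero_iff.2 fun k _ => hz k

lemma R_mul_herglotz {z : ℂ} (hz : ∀ k, ζ k - z ≠ 0) : R ζ z * herglotz ζ b z = Q ζ b z := by
  rw [herglotz, Q, Finset.mul_sum]
  refine Finset.sum_congr rfl fun k _ => ?_
  rw [R, ← Finset.mul_prod_erase _ _ (Finset.mem_univ k)]
  have := hz k
  field_simp

lemma herglotz_zero (hζ : ∀ k, ‖ζ k‖ = 1) : herglotz ζ b 0 = ((∑ k, b k : ℝ) : ℂ) := by
  have : ∀ k, ζ k ≠ 0 := fun k h => by simpa [h] using hζ k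
  simp [herglotz, this]

lemma re_add_div_sub {w z : ℂ} (hw : ‖w‖ = 1) :
    ((w + z) / (w - z)).re = (1 - ‖z‖ ^ 2) / ‖w - z‖ ^ 2 := by
  have h1 : w.re * w.re + w.im * w.im = 1 := by
    rw [← Complex.normSq_apply, Complex.normSq_eq_norm_sq, hw, one_pow]
  rw [Complex.div_re, ← Complex.normSq_eq_norm_sq, ← Complex.normSq_eq_norm_sq, ← add_div]
  congr 1
  simp [Complex.normSq_apply]
  linear_combination h1

lemma herglotz_re (hζ : ∀ k, ‖ζ k‖ = 1) (z : ℂ) :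
    (herglotz ζ b z).re = (1 - ‖z‖ ^ 2) * ∑ k, b k / ‖ζ k - z‖ ^ 2 := by
  rw [herglotz, Complex.re_sum, Finset.mul_sum]
  refine Finset.sum_congr rfl fun k _ => ?_
  rw [Complex.re_ofReal_mul, re_add_div_sub (hζ k)]
  ring

lemma sub_ne_zero_of_mem_disc (hζ : ∀ k, ‖ζ k‖ = 1) {z : ℂ} (hz : z ∈ disc) (k : Fin n) :
    ζ k - z ≠ 0 := by
  intro h
  rw [sub_eq_zero] at h
  rw [mem_disc, ← h, hζ] at hz
  exact lt_irrefl _ hz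

/-- The sum `∑ₖ bₖ / |ζₖ - z|²`. -/
noncomputable def poissonSum (ζ : Fin n → ℂ) (b : Fin n → ℝ) (z : ℂ) : ℝ :=
  ∑ k, b k / ‖ζ k - z‖ ^ 2

lemma poissonSum_pos (hn : 1 ≤ n) (hb : ∀ k, 0 < b k) {z : ℂ} (hz : ∀ k, ζ k - z ≠ 0) :
    0 < poissonSum ζ b z :=
  Finset.sum_pos (fun k _ => div_pos (hb k) (pow_pos (norm_pos_iff.2 (hz k)) 2))
    ⟨⟨0, hn⟩, Finset.mem_univ _⟩

lemma herglotz_re_pos (hn : 1 ≤ n) (hζ : ∀ k, ‖ζ k‖ = 1) (hb : ∀ k, 0 < b k) {z : ℂ}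
    (hz : z ∈ disc) : 0 < (herglotz ζ b z).re := by
  rw [herglotz_re hζ]
  refine mul_pos ?_ (poissonSum_pos hn hb (sub_ne_zero_of_mem_disc hζ hz))
  have := mem_disc.1 hz
  nlinarith [norm_nonneg z]

lemma hasDerivAt_herglotz {z : ℂ} (hz : ∀ k, ζ k - z ≠ 0) :
    HasDerivAt (herglotz ζ b) (∑ k, (b k : ℂ) * (2 * ζ k / (ζ k - z) ^ 2)) z := by
  refine HasDerivAt.fun_sum fun k _ => HasDerivAt.const_mul _ ?_
  refine (((hasDerivAt_id z).const_add (ζ k)).div ((hasDerivAt_id z).const_sub (ζ k))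
    (hz k)).congr_deriv ?_
  simp only [id]
  congr 1
  ring

/-- On the unit circle `ζ z / (ζ - z)² = -1 / |ζ - z|²`. -/
lemma mul_div_sub_sq {w z : ℂ} (hw : ‖w‖ = 1) (hz : ‖z‖ = 1) (h : w - z ≠ 0) :
    z * (w / (w - z) ^ 2) = -((1 / ‖w - z‖ ^ 2 : ℝ) : ℂ) := by
  have hw0 : w ≠ 0 := fun h => by simp [h] at hw
  have hz0 : z ≠ 0 := fun h => by simp [h] at hz
  have h1 : ((‖w - z‖ ^ 2 : ℝ) : ℂ) = (w - z) * (w⁻¹ - z⁻¹) := by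
    push_cast
    rw [← Complex.mul_conj', map_sub, Complex.inv_eq_conj hw, Complex.inv_eq_conj hz]
  have h2 : w⁻¹ - z⁻¹ = -(w - z) / (w * z) := by
    field_simp
    ring
  rw [Complex.ofReal_div, h1, h2]
  field_simp
  simp

lemma mul_herglotz_deriv (hζ : ∀ k, ‖ζ k‖ = 1) {z : ℂ} (hz1 : ‖z‖ = 1)
    (hz : ∀ k, ζ k - z ≠ 0) :
    z * ∑ k, (b k : ℂ) * (2 * ζ k / (ζ k - z) ^ 2) = ((-2 * poissonSum ζ b z : ℝ) : ℂ) := by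
  rw [poissonSum, Finset.mul_sum, Finset.mul_sum, Complex.ofReal_sum]
  refine Finset.sum_congr rfl fun k _ => ?_
  have h := mul_div_sub_sq (hζ k) hz1 (hz k)
  calc _ = (b k : ℂ) * 2 * (z * (ζ k / (ζ k - z) ^ 2)) := by ring
    _ = _ := by
      rw [h]
      push_cast
      ring

/-- The leading coefficient `(-1)^{n-1} (b + ia)` of `Q - iaR`. -/
noncomputable def leadCoeff (b : Fin n → ℝ) (a : ℝ) : ℂ :=
  (-1) ^ (n - 1) * (((∑ k, b k : ℝ) : ℂ) + Complex.I * a)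

lemma Q_apply_self (k : Fin n) :
    Q ζ b (ζ k) = b k * (2 * ζ k) * ∏ j ∈ Finset.univ.erase k, (ζ j - ζ k) := by
  rw [Q, Finset.sum_eq_single k]
  · ring
  · intro j _ hj
    rw [Finset.prod_eq_zero (Finset.mem_erase.2 ⟨hj.symm, Finset.mem_univ k⟩) (sub_self _),
      mul_zero]
  · simp

lemma R_apply_self (k : Fin n) : R ζ (ζ k) = 0 :=
  Finset.prod_eq_zero (Finset.mem_univ k) (sub_self _)

lemma prod_erase_sub_ne_zero (hinj : Function.Injective ζ) (k : Fin n) :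
    ∏ j ∈ Finset.univ.erase k, (ζ j - ζ k) ≠ 0 :=
  Finset.prod_ne_zero_iff.2 fun _ hj =>
    sub_ne_zero.2 fun h => (Finset.ne_of_mem_erase hj) (hinj h)

namespace IsRootList

lemma eq_zero (h : IsRootList ζ b a ξ) (k : Fin n) :
    Q ζ b (ξ k) - Complex.I * a * R ζ (ξ k) = 0 := by
  rw [h (ξ k), Finset.prod_eq_zero (Finset.mem_univ k) (sub_self _), mul_zero]

lemma sub_ne_zero (h : IsRootList ζ b a ξ) (hζ : ∀ k, ‖ζ k‖ = 1)
    (hinj : Function.Injective ζ) (hb : ∀ k, 0 < b k) (k j : Fin n) : ζ j - ξ k ≠ 0 := by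
  intro hz
  have h1 := h.eq_zero k
  rw [← sub_eq_zero.1 hz, R_apply_self, Q_apply_self, mul_zero, sub_zero] at h1
  have h0 : ζ j ≠ 0 := fun h => by simpa [h] using hζ j
  have hb' : (b j : ℂ) ≠ 0 := by exact_mod_cast (hb j).ne'
  simp [h0, hb', prod_erase_sub_ne_zero hinj j] at h1

lemma herglotz_eq (h : IsRootList ζ b a ξ) {k : Fin n} (hk : ∀ j, ζ j - ξ k ≠ 0) :
    herglotz ζ b (ξ k) = Complex.I * a := by
  have h1 := h.eq_zero k
  rw [← R_mul_herglotz hk] at h1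
  have h2 := R_ne_zero hk
  refine mul_left_cancel₀ h2 ?_
  linear_combination h1

/-- At a root the Herglotz function is purely imaginary, which it is only on the unit circle. -/
lemma norm_eq_one (h : IsRootList ζ b a ξ) (hn : 1 ≤ n) (hζ : ∀ k, ‖ζ k‖ = 1)
    (hb : ∀ k, 0 < b k) {k : Fin n} (hk : ∀ j, ζ j - ξ k ≠ 0) : ‖ξ k‖ = 1 := by
  have h1 := congrArg Complex.re (h.herglotz_eq hk)
  rw [herglotz_re hζ] at h1
  have h2 := (poissonSum_pos hn hb hk).ne'
  rw [poissonSum] at h2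
  have h3 : 1 - ‖ξ k‖ ^ 2 = 0 := by simpa [h2] using h1
  have h4 : ‖ξ k‖ ^ 2 = 1 := by linarith
  exact (pow_eq_one_iff_of_nonneg (norm_nonneg _) two_ne_zero).1 h4

/-- The derivative of `Q - iaR = R (h - ia)` at a root, computed from both factorizations. -/
lemma leadCoeff_mul_prod (h : IsRootList ζ b a ξ) {k : Fin n} (hk : ∀ j, ζ j - ξ k ≠ 0) :
    leadCoeff b a * ∏ j ∈ Finset.univ.erase k, (ξ k - ξ j) =
      R ζ (ξ k) * ∑ j, (b j : ℂ) * (2 * ζ j / (ζ j - ξ k) ^ 2) := by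
  have h1 : HasDerivAt (fun z => (z - ξ k) * (leadCoeff b a *
      ∏ j ∈ Finset.univ.erase k, (z - ξ j)))
      (leadCoeff b a * ∏ j ∈ Finset.univ.erase k, (ξ k - ξ j)) (ξ k) := by
    have hd : DifferentiableAt ℂ (fun z => leadCoeff b a *
      ∏ j ∈ Finset.univ.erase k, (z - ξ j)) (ξ k) := by fun_prop
    have := ((hasDerivAt_id (ξ k)).sub_const (ξ k)).mul hd.hasDerivAt
    simpa using! this
  have h2 : HasDerivAt (fun z => R ζ z * (herglotz ζ b z - Complex.I * a))
      (R ζ (ξ k) * ∑ j, (b j : ℂ) * (2 * ζ j / (ζ j - ξ k) ^ 2)) (ξ k) := by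
    have hd : DifferentiableAt ℂ (R ζ) (ξ k) := by
      unfold R
      fun_prop
    refine (hd.hasDerivAt.mul ((hasDerivAt_herglotz hk).sub_const (Complex.I * a))).congr_deriv ?_
    rw [h.herglotz_eq hk]
    ring
  refine h1.unique (h2.congr_of_eventuallyEq ?_)
  have hev : ∀ᶠ z in 𝓝 (ξ k), ∀ j, ζ j - z ≠ 0 :=
    eventually_all.2 fun j =>
      (continuousAt_const.sub continuousAt_id).eventually_ne (hk j)
  filter_upwards [hev] with z hz
  rw [mul_sub, R_mul_herglotz hz, mul_comm (R ζ z), h z,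
    ← Finset.mul_prod_erase _ _ (Finset.mem_univ k), leadCoeff]
  ring

end IsRootList

lemma leadCoeff_ne_zero (hb : 0 < ∑ k, b k) : leadCoeff b a ≠ 0 := by
  refine mul_ne_zero (by simp) fun h => ?_
  have := congrArg Complex.re h
  simp at this
  rw [this] at hb
  exact lt_irrefl _ hb

lemma sum_pos_of_pos (hn : 1 ≤ n) (hb : ∀ k, 0 < b k) : 0 < ∑ k, b k :=
  Finset.sum_pos (fun k _ => hb k) ⟨⟨0, hn⟩, Finset.mem_univ _⟩

namespace IsRootList

/-- The roots are simple, since `ξ h'(ξ) < 0` at each of them for the Herglotz function `h`. -/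
lemma injective (h : IsRootList ζ b a ξ) (hn : 1 ≤ n) (hζ : ∀ k, ‖ζ k‖ = 1)
    (hb : ∀ k, 0 < b k) (hk : ∀ k j, ζ j - ξ k ≠ 0) : Function.Injective ξ := by
  intro k l hkl
  by_contra hne
  have h1 := h.leadCoeff_mul_prod (hk k)
  rw [Finset.prod_eq_zero (Finset.mem_erase.2 ⟨Ne.symm hne, Finset.mem_univ l⟩)
    (_root_.sub_eq_zero.2 hkl), mul_zero, eq_comm, mul_eq_zero,
    or_iff_right (R_ne_zero (hk k))] at h1
  have h2 := mul_herglotz_deriv (b := b) hζ (h.norm_eq_one hn hζ hb (hk k)) (hk k)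
  rw [h1, mul_zero, eq_comm, Complex.ofReal_eq_zero] at h2
  linarith [poissonSum_pos hn hb (hk k)]

lemma residue_eq (h : IsRootList ζ b a ξ) (hn : 1 ≤ n) (hζ : ∀ k, ‖ζ k‖ = 1)
    (hb : ∀ k, 0 < b k) (hk : ∀ k j, ζ j - ξ k ≠ 0) (k : Fin n) :
    residue ζ ξ k = leadCoeff b a * ((-1 / (2 * poissonSum ζ b (ξ k)) : ℝ) : ℂ) := by
  have hl := leadCoeff_ne_zero (a := a) (sum_pos_of_pos hn hb)
  have h1 := h.leadCoeff_mul_prod (hk k)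
  have h2 := mul_herglotz_deriv (b := b) hζ (h.norm_eq_one hn hζ hb (hk k)) (hk k)
  have hs : ((poissonSum ζ b (ξ k) : ℝ) : ℂ) ≠ 0 := by
    exact_mod_cast (poissonSum_pos hn hb (hk k)).ne'
  have hR := R_ne_zero (hk k)
  have h0 : ξ k ≠ 0 := fun h0 => by
    have := h.norm_eq_one hn hζ hb (hk k)
    simp [h0] at this
  have h3 : leadCoeff b a * (ξ k * ∏ j ∈ Finset.univ.erase k, (ξ k - ξ j)) =
      R ζ (ξ k) * (-2 * poissonSum ζ b (ξ k)) := by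
    have : ((-2 * poissonSum ζ b (ξ k) : ℝ) : ℂ) = -2 * poissonSum ζ b (ξ k) := by push_cast; ring
    rw [← this, ← h2]
    linear_combination (ξ k) * h1
  have hden : ξ k * ∏ j ∈ Finset.univ.erase k, (ξ k - ξ j) ≠ 0 := by
    intro hz
    rw [hz, mul_zero] at h3
    simp [hR, hs] at h3
  rw [residue, div_eq_iff hden]
  push_cast
  field_simp
  linear_combination h3

/-- The value at the origin: `(b - ia) R(0) = (-1)^{n-1} (b + ia) ∏ₖ (-ξₖ)`. -/
lemma R_zero (h : IsRootList ζ b a ξ) (hζ : ∀ k, ‖ζ k‖ = 1) :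
    (((∑ k, b k : ℝ) : ℂ) - Complex.I * a) * R ζ 0 = leadCoeff b a * ∏ k, (0 - ξ k) := by
  rw [leadCoeff, ← h 0, ← R_mul_herglotz (sub_ne_zero_of_mem_disc hζ zero_mem_disc),
    herglotz_zero hζ]
  ring

end IsRootList

/-- `β + ia` in polar form, with modulus `β / cos (arctan (a / β))`. -/
lemma add_I_mul_eq {β : ℝ} (hβ : 0 < β) (a : ℝ) :
    (β : ℂ) + Complex.I * a = ((β / Real.cos (Real.arctan (a / β)) : ℝ) : ℂ) *
      Complex.exp (Complex.I * Real.arctan (a / β)) := by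
  have hc := (Real.cos_arctan_pos (a / β)).ne'
  have hs : Real.sin (Real.arctan (a / β)) = a / β * Real.cos (Real.arctan (a / β)) := by
    have := Real.tan_arctan (a / β)
    rwa [Real.tan_eq_sin_div_cos, div_eq_iff hc] at this
  have hc' : ((Real.cos (Real.arctan (a / β)) : ℝ) : ℂ) ≠ 0 := by exact_mod_cast hc
  have hβ' : (β : ℂ) ≠ 0 := by exact_mod_cast hβ.ne'
  rw [mul_comm Complex.I (Real.arctan (a / β) : ℂ), Complex.exp_mul_I, ← Complex.ofReal_cos,
    ← Complex.ofReal_sin, hs]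
  push_cast at hc' ⊢
  field_simp

lemma sub_I_mul_eq {β : ℝ} (hβ : 0 < β) (a : ℝ) :
    (β : ℂ) - Complex.I * a = ((β / Real.cos (Real.arctan (a / β)) : ℝ) : ℂ) *
      Complex.exp (-(Complex.I * Real.arctan (a / β))) := by
  have := add_I_mul_eq hβ (-a)
  rw [neg_div, Real.arctan_neg, Real.cos_neg] at this
  simpa [sub_eq_add_neg] using this

/-- The exponents: `αₖ = -|b + ia| / (4 ∑ⱼ bⱼ / |ζⱼ - ξₖ|²)`, where `|b + ia| = b / cos ψ`. -/
noncomputable def exponent (ζ : Fin n → ℂ) (b : Fin n → ℝ) (a : ℝ) (ξ : Fin n → ℂ) (k : Fin n) :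
    ℝ :=
  -((∑ j, b j) / Real.cos (Real.arctan (a / ∑ j, b j))) / (4 * poissonSum ζ b (ξ k))

lemma exponent_neg (hn : 1 ≤ n) (hb : ∀ k, 0 < b k) (hk : ∀ k j, ζ j - ξ k ≠ 0) (k : Fin n) :
    exponent ζ b a ξ k < 0 := by
  have h1 := poissonSum_pos hn hb (hk k)
  have h2 := sum_pos_of_pos hn hb
  have h3 := Real.cos_arctan_pos (a / ∑ j, b j)
  rw [exponent, neg_div, neg_lt_zero]
  positivity

namespace IsRootList

lemma residue_eq_exponent (h : IsRootList ζ b a ξ) (hn : 1 ≤ n) (hζ : ∀ k, ‖ζ k‖ = 1)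
    (hb : ∀ k, 0 < b k) (hk : ∀ k j, ζ j - ξ k ≠ 0) (k : Fin n) :
    residue ζ ξ k = 2 * (-1) ^ (n - 1) *
      Complex.exp (Complex.I * Real.arctan (a / ∑ j, b j)) * exponent ζ b a ξ k := by
  have hs : ((poissonSum ζ b (ξ k) : ℝ) : ℂ) ≠ 0 := by
    exact_mod_cast (poissonSum_pos hn hb (hk k)).ne'
  rw [h.residue_eq hn hζ hb hk, leadCoeff, add_I_mul_eq (sum_pos_of_pos hn hb), exponent]
  generalize (∑ j, b j) / Real.cos (Real.arctan (a / ∑ j, b j)) = q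
  push_cast
  field_simp
  ring

lemma ne_zero (h : IsRootList ζ b a ξ) (hn : 1 ≤ n) (hζ : ∀ k, ‖ζ k‖ = 1)
    (hb : ∀ k, 0 < b k) (hk : ∀ k j, ζ j - ξ k ≠ 0) (k : Fin n) : ξ k ≠ 0 := fun h0 => by
  have := h.norm_eq_one hn hζ hb (hk k)
  simp [h0] at this

lemma R_zero_eq (h : IsRootList ζ b a ξ) (hn : 1 ≤ n) (hζ : ∀ k, ‖ζ k‖ = 1)
    (hb : ∀ k, 0 < b k) :
    R ζ 0 = (-1) ^ (n - 1) * Complex.exp (Complex.I * Real.arctan (a / ∑ j, b j)) ^ 2 *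
      ∏ k, (0 - ξ k) := by
  have hβ := sum_pos_of_pos hn hb
  have h1 := h.R_zero hζ
  have hq : ((((∑ j, b j) / Real.cos (Real.arctan (a / ∑ j, b j)) : ℝ)) : ℂ) ≠ 0 := by
    exact_mod_cast (div_pos hβ (Real.cos_arctan_pos _)).ne'
  rw [leadCoeff, add_I_mul_eq hβ, sub_I_mul_eq hβ, Complex.exp_neg] at h1
  refine mul_left_cancel₀ (mul_ne_zero hq (inv_ne_zero
    (Complex.exp_ne_zero (Complex.I * Real.arctan (a / ∑ j, b j))))) ?_
  rw [h1]
  have he := Complex.exp_ne_zero (Complex.I * Real.arctan (a / ∑ j, b j))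
  field_simp

lemma sum_exponent (h : IsRootList ζ b a ξ) (hn : 1 ≤ n) (hζ : ∀ k, ‖ζ k‖ = 1)
    (hb : ∀ k, 0 < b k) (hk : ∀ k j, ζ j - ξ k ≠ 0) :
    ∑ k, exponent ζ b a ξ k = -Real.cos (Real.arctan (a / ∑ j, b j)) := by
  have h1 := (partial_fractions hn ζ ξ (h.injective hn hζ hb hk) (h.ne_zero hn hζ hb hk) _
    (h.R_zero_eq hn hζ hb)).2
  simp only [h.residue_eq_exponent hn hζ hb hk] at h1
  rw [← Finset.mul_sum] at h1
  have h3 : ((-1 : ℂ)) ^ n = (-1) ^ (n - 1) * (-1) := by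
    rw [← pow_succ, Nat.sub_add_cancel hn]
  rw [h3] at h1
  have h4 : ((-1 : ℂ)) ^ (n - 1) ≠ 0 := by simp
  set E := Complex.exp (Complex.I * Real.arctan (a / ∑ j, b j)) with hE
  have hE0 : E ≠ 0 := Complex.exp_ne_zero _
  have h5 : -1 = E ^ 2 + 2 * E * ∑ k, (exponent ζ b a ξ k : ℂ) := by
    refine mul_left_cancel₀ h4 ?_
    rw [h1]
    ring
  have h6 : (Real.cos (Real.arctan (a / ∑ j, b j)) : ℂ) = (E + E⁻¹) / 2 := by
    rw [hE, Complex.ofReal_cos, Complex.cos, ← Complex.exp_neg]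
    congr 2
    · rw [mul_comm]
    · rw [neg_mul, mul_comm]
  apply Complex.ofReal_injective
  rw [Complex.ofReal_neg, h6]
  push_cast
  refine mul_left_cancel₀ hE0 ?_
  field_simp
  linear_combination -h5

/-- The partial fractions of `(b - ia) R / (Q - iaR)`, with the denominator cleared. -/
lemma one_add_mul (h : IsRootList ζ b a ξ) (hn : 1 ≤ n) (hζ : ∀ k, ‖ζ k‖ = 1)
    (hb : ∀ k, 0 < b k) (hk : ∀ k j, ζ j - ξ k ≠ 0) {z : ℂ} (hz : ∀ k, z - ξ k ≠ 0) :
    (1 + z * (Complex.exp (-(Complex.I * Real.arctan (a / ∑ j, b j))) *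
      ∑ k, 2 * (exponent ζ b a ξ k : ℂ) / (z - ξ k))) * (Q ζ b z - Complex.I * a * R ζ z) =
      (((∑ k, b k : ℝ) : ℂ) - Complex.I * a) * R ζ z := by
  have hβ := sum_pos_of_pos hn hb
  have h1 := (partial_fractions hn ζ ξ (h.injective hn hζ hb hk) (h.ne_zero hn hζ hb hk) _
    (h.R_zero_eq hn hζ hb)).1 z
  have hsum : ∑ k, residue ζ ξ k * ∏ j ∈ Finset.univ.erase k, (z - ξ j) =
      (-1) ^ (n - 1) * Complex.exp (Complex.I * Real.arctan (a / ∑ j, b j)) *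
        (∏ k, (z - ξ k)) * ∑ k, 2 * (exponent ζ b a ξ k : ℂ) / (z - ξ k) := by
    rw [Finset.mul_sum]
    refine Finset.sum_congr rfl fun k _ => ?_
    rw [h.residue_eq_exponent hn hζ hb hk, ← Finset.mul_prod_erase _ _ (Finset.mem_univ k)]
    have := hz k
    field_simp
  rw [hsum] at h1
  rw [h z, h1, add_I_mul_eq hβ, sub_I_mul_eq hβ, Complex.exp_neg]
  have he := Complex.exp_ne_zero (Complex.I * Real.arctan (a / ∑ j, b j))
  field_simp

end IsRootList

/-! ### Branches of the power product -/

/-- On the domain where all the `1 - z / ξₖ` avoid the negative axis, the principal branches give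
`log (∏ₖ (1 - z / ξₖ) ^ (2 αₖ)) ^ c`. -/
noncomputable def logProduct (ξ : Fin n → ℂ) (α : Fin n → ℝ) (c z : ℂ) : ℂ :=
  c * ∑ k, 2 * (α k : ℂ) * Complex.log (1 - z / ξ k)

lemma hasDerivAt_log_one_sub_div {w z : ℂ} (hw : w ≠ 0) (h : 1 - z / w ∈ Complex.slitPlane) :
    HasDerivAt (fun z => Complex.log (1 - z / w)) (1 / (z - w)) z := by
  have h1 : HasDerivAt (fun z => 1 - z / w) (-(1 / w)) z :=
    ((hasDerivAt_id z).div_const w).const_sub 1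
  refine (h1.clog h).congr_deriv ?_
  have h2 : 1 - z / w ≠ 0 := Complex.slitPlane_ne_zero h
  have h3 : z - w ≠ 0 := fun h => h2 (by rw [sub_eq_zero.1 h, div_self hw, sub_self])
  have h4 : w - z ≠ 0 := fun h => h3 (by linear_combination -h)
  have h5 : 1 - z / w = (w - z) / w := by field_simp
  rw [h5]
  field_simp
  ring

lemma hasDerivAt_logProduct {α : Fin n → ℝ} {c z : ℂ} (h0 : ∀ k, ξ k ≠ 0)
    (h : ∀ k, 1 - z / ξ k ∈ Complex.slitPlane) :
    HasDerivAt (logProduct ξ α c) (c * ∑ k, 2 * (α k : ℂ) / (z - ξ k)) z := by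
  refine HasDerivAt.const_mul c (HasDerivAt.fun_sum fun k _ => ?_)
  refine ((hasDerivAt_log_one_sub_div (h0 k) (h k)).const_mul (2 * (α k : ℂ))).congr_deriv ?_
  rw [mul_one_div]

lemma one_sub_div_mem_slitPlane {w z : ℂ} (hw : ‖w‖ = 1) (hz : ‖z‖ ≤ 1) (hne : w - z ≠ 0) :
    1 - z / w ∈ Complex.slitPlane := by
  refine Or.inl ?_
  have hw0 : w ≠ 0 := fun h => by simp [h] at hw
  have h1 : ‖z / w‖ ≤ 1 := by rw [norm_div, hw, div_one]; exact hz
  rw [Complex.sub_re, Complex.one_re, sub_pos]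
  refine lt_of_le_of_ne ((Complex.re_le_norm _).trans h1) fun h => hne ?_
  -- a point of the closed disc with real part `1` is `1` itself
  have h2 : (z / w).im = 0 := by
    have h3 := Complex.normSq_apply (z / w)
    rw [Complex.normSq_eq_norm_sq, h] at h3
    have h4 : ‖z / w‖ ^ 2 ≤ 1 := pow_le_one₀ (norm_nonneg _) h1
    have h5 : (z / w).im * (z / w).im = 0 :=
      le_antisymm (by linarith) (mul_self_nonneg _)
    exact mul_self_eq_zero.1 h5
  have h6 : z / w = 1 := Complex.ext h h2
  rw [div_eq_one_iff_eq hw0] at h6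
  rw [h6, sub_self]

lemma one_sub_div_mem_slitPlane_of_mem_disc (hξ : ∀ k, ‖ξ k‖ = 1) {z : ℂ} (hz : z ∈ disc)
    (k : Fin n) : 1 - z / ξ k ∈ Complex.slitPlane :=
  one_sub_div_mem_slitPlane (hξ k) (mem_disc.1 hz).le (sub_ne_zero_of_mem_disc hξ hz k)

lemma exists_isPowerProduct (hξ : ∀ k, ‖ξ k‖ = 1) (α : Fin n → ℝ) (c : ℂ) :
    ∃ φ, IsPowerProduct ξ α c φ := by
  have h0 : ∀ k, ξ k ≠ 0 := fun k h => by simpa [h] using hξ k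
  have hd : ∀ k, DifferentiableOn ℂ
      (fun z => Complex.log (1 - z / ξ k) + Complex.log (-ξ k)) disc := fun k z hz =>
    ((hasDerivAt_log_one_sub_div (h0 k)
      (one_sub_div_mem_slitPlane_of_mem_disc hξ hz k)).add_const
        _).differentiableAt.differentiableWithinAt
  refine ⟨fun z => z * Complex.exp (c * ∑ k, 2 * (α k : ℂ) *
      (Complex.log (1 - z / ξ k) + Complex.log (-ξ k))),
    fun k z => Complex.log (1 - z / ξ k) + Complex.log (-ξ k),
    fun z => ∑ k, 2 * (α k : ℂ) * (Complex.log (1 - z / ξ k) + Complex.log (-ξ k)),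
    fun k => ⟨hd k, fun z hz => ?_⟩, ?_, fun z _ => Complex.exp_sum _ _, fun z _ => rfl⟩
  · rw [Complex.exp_add, Complex.exp_log (Complex.slitPlane_ne_zero
      (one_sub_div_mem_slitPlane_of_mem_disc hξ hz k)), Complex.exp_log (neg_ne_zero.2 (h0 k))]
    have := h0 k
    field_simp
    ring
  · exact DifferentiableOn.fun_sum fun k _ => (hd k).const_mul _

/-- A holomorphic logarithm has the logarithmic derivative as its derivative. -/
lemma deriv_eq_of_exp_eq {f g : ℂ → ℂ} {g' z : ℂ} (hf : DifferentiableOn ℂ f disc)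
    (hfg : ∀ z ∈ disc, Complex.exp (f z) = g z) (hz : z ∈ disc) (hg : HasDerivAt g g' z) :
    deriv f z = g' / g z := by
  have h1 := (hf.differentiableAt (disc_mem_nhds hz)).hasDerivAt.cexp
  have h2 := h1.unique (hg.congr_of_eventuallyEq (eventually_of_mem (disc_mem_nhds hz) hfg))
  rw [← hfg z hz, ← h2, mul_div_cancel_left₀ _ (Complex.exp_ne_zero _)]

/-- All branches agree with the one built from the principal logarithms up to a constant factor. -/
lemma IsPowerProduct.exists_eq {α : Fin n → ℝ} {c : ℂ} {φ : ℂ → ℂ}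
    (h : IsPowerProduct ξ α c φ) (hξ : ∀ k, ‖ξ k‖ = 1) :
    ∃ C, ∀ z ∈ disc, φ z = z * Complex.exp (logProduct ξ α c z + C) := by
  obtain ⟨l, L, hl, hL, hexp, hφ⟩ := h
  have h0 : ∀ k, ξ k ≠ 0 := fun k h => by simpa [h] using hξ k
  have hlder : ∀ k, ∀ z ∈ disc, HasDerivAt (l k) (1 / (z - ξ k)) z := by
    intro k z hz
    have := deriv_eq_of_exp_eq (hl k).1 (hl k).2 hz ((hasDerivAt_id z).sub_const (ξ k))
    rw [show 1 / (z - ξ k) = deriv (l k) z from this.symm]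
    exact ((hl k).1.differentiableAt (disc_mem_nhds hz)).hasDerivAt
  have hLder : ∀ z ∈ disc, HasDerivAt L (∑ k, 2 * (α k : ℂ) / (z - ξ k)) z := by
    intro z hz
    have h1 : HasDerivAt (fun z => Complex.exp (∑ k, 2 * (α k : ℂ) * l k z))
        (Complex.exp (∑ k, 2 * (α k : ℂ) * l k z) * ∑ k, 2 * (α k : ℂ) * (1 / (z - ξ k))) z :=
      (HasDerivAt.fun_sum fun k _ => (hlder k z hz).const_mul _).cexp
    have := deriv_eq_of_exp_eq hL (fun z hz => (hexp z hz).trans (Complex.exp_sum _ _).symm) hz h1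
    rw [mul_div_cancel_left₀ _ (Complex.exp_ne_zero _)] at this
    simp only [mul_one_div] at this
    rw [← this]
    exact (hL.differentiableAt (disc_mem_nhds hz)).hasDerivAt
  have hder : ∀ z ∈ disc, HasDerivAt (fun z => c * L z - logProduct ξ α c z) 0 z := by
    intro z hz
    refine (((hLder z hz).const_mul c).sub (hasDerivAt_logProduct h0 fun k =>
      one_sub_div_mem_slitPlane_of_mem_disc hξ hz k)).congr_deriv (sub_self _)
  obtain ⟨C, hC⟩ := isOpen_disc.exists_is_const_of_deriv_eq_zero
    (convex_ball (0 : ℂ) 1).isPreconnected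
    (fun z hz => (hder z hz).differentiableAt.differentiableWithinAt)
    fun z hz => (hder z hz).deriv
  refine ⟨C, fun z hz => ?_⟩
  rw [hφ z hz, ← hC z hz]
  congr 2
  ring

lemma continuousOn_herglotz (hζ : ∀ k, ‖ζ k‖ = 1) : ContinuousOn (herglotz ζ b) disc :=
  fun _ hz => (hasDerivAt_herglotz (sub_ne_zero_of_mem_disc hζ hz)).continuousAt.continuousWithinAt

/-- Every branch of the power product is a Koenigs function for `p = h - ia`, `h` the Herglotz
function. -/
lemma IsRootList.isKoenigs (h : IsRootList ζ b a ξ) (hn : 1 ≤ n) (hζ : ∀ k, ‖ζ k‖ = 1)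
    (hb : ∀ k, 0 < b k) (hk : ∀ k j, ζ j - ξ k ≠ 0) {φ : ℂ → ℂ} {C : ℂ}
    (hφ : ∀ z ∈ disc, φ z = z * Complex.exp (logProduct ξ (exponent ζ b a ξ)
      (Complex.exp (-(Complex.I * Real.arctan (a / ∑ j, b j)))) z + C)) :
    IsKoenigs (fun z => herglotz ζ b z - Complex.I * a)
      (fun z => logProduct ξ (exponent ζ b a ξ)
        (Complex.exp (-(Complex.I * Real.arctan (a / ∑ j, b j)))) z + C) φ := by
  have hξ := fun k => h.norm_eq_one hn hζ hb (hk k)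
  have h0 := h.ne_zero hn hζ hb hk
  have hder := fun z (hz : z ∈ disc) => (hasDerivAt_logProduct (α := exponent ζ b a ξ)
    (c := Complex.exp (-(Complex.I * Real.arctan (a / ∑ j, b j)))) h0
      fun k => one_sub_div_mem_slitPlane_of_mem_disc hξ hz k).add_const C
  refine ⟨(continuousOn_herglotz hζ).sub continuousOn_const, fun z hz => ?_,
    fun z hz => (hder z hz).differentiableAt.differentiableWithinAt, fun z hz => ?_, hφ⟩
  · simpa using herglotz_re_pos hn hζ hb hz
  · have hz' := sub_ne_zero_of_mem_disc hζ hz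
    have h1 := h.one_add_mul hn hζ hb hk (z := z) fun k hz0 =>
      sub_ne_zero_of_mem_disc hξ hz k (by linear_combination -hz0)
    rw [(hder z hz).deriv]
    refine mul_left_cancel₀ (R_ne_zero hz') ?_
    rw [herglotz_zero hζ, mul_comm (R ζ z) (_ - _), ← h1, ← R_mul_herglotz hz']
    ring

end Roots

/-! ### The normal arc at a simple pole of `p` -/

/-- A function whose derivative vanishes to first order is quadratic to leading order. -/
lemma exists_eq_sq_mul {f κ : ℂ → ℂ} {z₀ : ℂ} (hf : AnalyticAt ℂ f z₀) (h0 : f z₀ = 0)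
    (hκ : ContinuousAt κ z₀) (hd : ∀ᶠ z in 𝓝 z₀, deriv f z = (z - z₀) * κ z) :
    ∃ g : ℂ → ℂ, AnalyticAt ℂ g z₀ ∧ g z₀ = κ z₀ / 2 ∧ ∀ᶠ z in 𝓝 z₀, f z = (z - z₀) ^ 2 * g z := by
  have hord : ((2 : ℕ) : ℕ∞) ≤ analyticOrderAt f z₀ := by
    rw [natCast_le_analyticOrderAt_iff_iteratedDeriv_eq_zero hf]
    intro i hi
    interval_cases i
    · simpa using h0
    · simpa using hd.self_of_nhds
  obtain ⟨g, hg, hfg⟩ := (natCast_le_analyticOrderAt hf).1 hord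
  simp only [smul_eq_mul] at hfg
  refine ⟨g, hg, ?_, hfg⟩
  have hev : ∀ᶠ z in 𝓝[≠] z₀, κ z = 2 * g z + (z - z₀) * deriv g z := by
    filter_upwards [nhdsWithin_le_nhds hd, nhdsWithin_le_nhds hfg.eventually_nhds,
      nhdsWithin_le_nhds hg.eventually_analyticAt, self_mem_nhdsWithin] with z hz1 hz2 hz3 hz
    have hz' : z - z₀ ≠ 0 := sub_ne_zero.2 hz
    have h1 : HasDerivAt (fun z => (z - z₀) ^ 2 * g z)
        (2 * (z - z₀) * g z + (z - z₀) ^ 2 * deriv g z) z := by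
      have := (((hasDerivAt_id z).sub_const z₀).pow 2).mul hz3.differentiableAt.hasDerivAt
      refine this.congr_deriv ?_
      simp
    have h2 := (h1.congr_of_eventuallyEq hz2).deriv
    rw [hz1] at h2
    refine mul_left_cancel₀ hz' ?_
    rw [h2]
    ring
  have hlim : Tendsto (fun z => 2 * g z + (z - z₀) * deriv g z) (𝓝[≠] z₀)
      (𝓝 (2 * g z₀ + (z₀ - z₀) * deriv g z₀)) :=
    ((continuousAt_const.mul hg.continuousAt).add ((continuousAt_id.sub continuousAt_const).mul
      hg.deriv.continuousAt)).tendsto.mono_left nhdsWithin_le_nhds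
  have := tendsto_nhds_unique (hκ.tendsto.mono_left nhdsWithin_le_nhds)
    (hlim.congr' (hev.mono fun z hz => hz.symm))
  rw [this]
  ring

/-- The equation `x² E(x) = s²`, with `E(0) = d²`, has a solution `x = s / d + o(s)`: it is
`S(x) = s` for the locally invertible `S(x) = x √E(x)`. -/
lemma exists_solution_sq {E : ℂ → ℂ} (hE : AnalyticAt ℂ E 0) {d : ℂ} (hd : d ≠ 0)
    (hE0 : E 0 = d ^ 2) :
    ∃ T : ℂ → ℂ, T 0 = 0 ∧ HasDerivAt T d⁻¹ 0 ∧ ∀ᶠ s in 𝓝 0, T s ^ 2 * E (T s) = s ^ 2 := by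
  set S : ℂ → ℂ := fun x => x * (d * Complex.exp (Complex.log (E x / d ^ 2) / 2)) with hS
  have hE1 : E 0 / d ^ 2 = 1 := by rw [hE0, div_self (pow_ne_zero 2 hd)]
  have han : AnalyticAt ℂ (fun x => d * Complex.exp (Complex.log (E x / d ^ 2) / 2)) 0 := by
    refine analyticAt_const.mul (AnalyticAt.cexp' (AnalyticAt.div_const (AnalyticAt.clog
      (hE.div_const) ?_)))
    rw [hE1]
    exact Complex.one_mem_slitPlane
  have hSd : HasStrictDerivAt S d 0 := by
    have h1 := (hasStrictDerivAt_id (0 : ℂ)).mul han.hasStrictDerivAt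
    refine h1.congr_deriv ?_
    simp [hE1]
  have hS0 : S 0 = 0 := by simp [hS]
  have hT := hSd.to_localInverse hd
  have hT0 : hSd.localInverse S d 0 hd 0 = 0 := by
    have := (hSd.hasStrictFDerivAt_equiv hd).localInverse_apply_image
    rw [hS0] at this
    exact this
  have hinv : ∀ᶠ s in 𝓝 (0 : ℂ), S (hSd.localInverse S d 0 hd s) = s := by
    have := (hSd.hasStrictFDerivAt_equiv hd).eventually_right_inverse
    rwa [hS0] at this
  rw [hS0] at hT
  refine ⟨hSd.localInverse S d 0 hd, hT0, hT.hasDerivAt, ?_⟩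
  have hTc : Tendsto (hSd.localInverse S d 0 hd) (𝓝 0) (𝓝 0) := by
    have := hT.hasDerivAt.continuousAt.tendsto
    rwa [hT0] at this
  have hne : ∀ᶠ s in 𝓝 (0 : ℂ), E (hSd.localInverse S d 0 hd s) ≠ 0 :=
    hTc.eventually (hE.continuousAt.eventually_ne (by rw [hE0]; exact pow_ne_zero 2 hd))
  filter_upwards [hinv, hne] with s hs hEs
  have h1 : Complex.exp (Complex.log (E (hSd.localInverse S d 0 hd s) / d ^ 2) / 2) ^ 2 =
      E (hSd.localInverse S d 0 hd s) / d ^ 2 := by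
    rw [← Complex.exp_nat_mul]
    push_cast
    rw [mul_div_cancel₀ _ (two_ne_zero : (2 : ℂ) ≠ 0),
      Complex.exp_log (div_ne_zero hEs (pow_ne_zero 2 hd))]
  nth_rewrite 3 [← hs]
  simp only [hS]
  rw [mul_pow, mul_pow, h1, mul_div_cancel₀ _ (pow_ne_zero 2 hd)]

lemma tendsto_ofReal_sqrt : Tendsto (fun t : ℝ => (√t : ℂ)) (𝓝[>] 0) (𝓝 0) := by
  have h : Continuous fun t : ℝ => (√t : ℂ) := by fun_prop
  exact (h.tendsto' 0 0 (by simp)).mono_left nhdsWithin_le_nhds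

/-- Curves `ζ (1 - x(t))` with `x(t) ~ r √t`, `r > 0`, enter the disc along the inner normal. -/
lemma arc_of_tendsto_div_sqrt {ζ : ℂ} (hζ : ‖ζ‖ = 1) {x : ℝ → ℂ} {r : ℝ} (hr : 0 < r)
    (hx : Tendsto (fun t : ℝ => x t / (√t : ℂ)) (𝓝[>] 0) (𝓝 (r : ℂ))) :
    (∀ᶠ t in 𝓝[>] 0, ζ * (1 - x t) ∈ disc) ∧
    Tendsto (fun t => ζ * (1 - x t)) (𝓝[>] 0) (𝓝 ζ) ∧
    Tendsto (fun t => (ζ * (1 - x t) - ζ) / (‖ζ * (1 - x t) - ζ‖ : ℂ)) (𝓝[>] 0) (𝓝 (-ζ)) := by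
  have hsqrt : Tendsto (fun t : ℝ => √t) (𝓝[>] 0) (𝓝 0) := by
    have := (Real.continuous_sqrt.tendsto 0).mono_left (nhdsWithin_le_nhds (s := Ioi 0))
    simpa using this
  have hsqrtC := tendsto_ofReal_sqrt
  have hpos : ∀ᶠ t : ℝ in 𝓝[>] 0, 0 < √t := by
    filter_upwards [self_mem_nhdsWithin] with t ht using Real.sqrt_pos.2 ht
  have hx0 : Tendsto x (𝓝[>] 0) (𝓝 0) := by
    have := hx.mul hsqrtC
    rw [mul_zero] at this
    refine this.congr' ?_
    filter_upwards [hpos] with t ht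
    have : (√t : ℂ) ≠ 0 := by exact_mod_cast ht.ne'
    field_simp
  refine ⟨?_, ?_, ?_⟩
  · have h1 : Tendsto (fun t : ℝ => 2 * (x t / (√t : ℂ)).re - √t * ‖x t / (√t : ℂ)‖ ^ 2)
        (𝓝[>] 0) (𝓝 (2 * r)) := by
      have := (((Complex.continuous_re.tendsto _).comp hx).const_mul 2).sub
        (hsqrt.mul (hx.norm.pow 2))
      simpa using this
    filter_upwards [h1.eventually_const_lt (by positivity : (0 : ℝ) < 2 * r), hpos] with t h2 ht
    rw [mem_disc, norm_mul, hζ, one_mul]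
    refine lt_of_pow_lt_pow_left₀ 2 zero_le_one ?_
    have h3 : x t = (√t : ℂ) * (x t / (√t : ℂ)) := by
      have : (√t : ℂ) ≠ 0 := by exact_mod_cast ht.ne'
      field_simp
    set y := x t / (√t : ℂ) with hy
    have h4 : ‖1 - x t‖ ^ 2 = 1 - √t * (2 * y.re - √t * ‖y‖ ^ 2) := by
      rw [h3, ← Complex.normSq_eq_norm_sq, ← Complex.normSq_eq_norm_sq, Complex.normSq_apply,
        Complex.normSq_apply]
      simp
      ring
    rw [h4]
    have := mul_pos ht h2
    linarith
  · have := (hx0.const_sub 1).const_mul ζ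
    simpa using this
  · have hr' : (r : ℂ) ≠ 0 := by exact_mod_cast hr.ne'
    have h1 := hx.div ((Complex.continuous_ofReal.tendsto _).comp hx.norm)
      (by simpa using hr')
    have h2 := h1.const_mul (-ζ)
    have h3 : (r : ℂ) / ((‖(r : ℂ)‖ : ℝ) : ℂ) = 1 := by
      rw [Complex.norm_of_nonneg hr.le, div_self hr']
    rw [h3, mul_one] at h2
    refine h2.congr' ?_
    filter_upwards [hpos] with t ht
    have hs : (√t : ℂ) ≠ 0 := by exact_mod_cast ht.ne'
    have h5 : ζ * (1 - x t) - ζ = -ζ * x t := by ring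
    simp only [Pi.div_apply, Function.comp]
    rw [h5, norm_mul, norm_neg, hζ, one_mul, norm_div, Complex.norm_of_nonneg ht.le]
    push_cast
    rw [div_div_div_cancel_right₀ hs, mul_div_assoc]

/-- If the logarithmic derivative `1 / z + M'` of `z exp (M z)` has a simple zero at the boundary
point `ζ`, with the coefficient that belongs to a simple pole of `p`, then the preimage of the
spiral `exp (-μ t) ζ exp (M ζ)` has a branch that enters the disc along the normal at `ζ`. -/
lemma exists_arc {M κ : ℂ → ℂ} {ζ μ : ℂ} {b : ℝ} (hζ : ‖ζ‖ = 1) (hμ : μ ≠ 0) (hb : 0 < b)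
    (hM : AnalyticAt ℂ M ζ) (hκ : ContinuousAt κ ζ) (hκ0 : κ ζ = -μ / (2 * b * ζ))
    (heq : ∀ᶠ z in 𝓝 ζ, 1 + z * deriv M z = (z - ζ) * κ z) :
    ∃ v : ℝ → ℂ, (∀ᶠ t in 𝓝[>] 0, v t ∈ disc ∧
        v t * Complex.exp (M (v t)) = Complex.exp (-μ * t) * (ζ * Complex.exp (M ζ))) ∧
      Tendsto v (𝓝[>] 0) (𝓝 ζ) ∧
      Tendsto (fun t => (v t - ζ) / (‖v t - ζ‖ : ℂ)) (𝓝[>] 0) (𝓝 (-ζ)) := by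
  have hζ0 : ζ ≠ 0 := fun h => by simp [h] at hζ
  have hb' : (b : ℂ) ≠ 0 := by exact_mod_cast hb.ne'
  -- the logarithm of `z exp (M z) / (ζ exp (M ζ))`
  set G : ℂ → ℂ := fun z => Complex.log (z / ζ) + M z - M ζ with hG
  have hslit : ∀ᶠ z in 𝓝 ζ, z / ζ ∈ Complex.slitPlane := by
    have : ContinuousAt (fun z => z / ζ) ζ := by fun_prop
    refine this.tendsto (Complex.isOpen_slitPlane.mem_nhds ?_)
    rw [div_self hζ0]
    exact Complex.one_mem_slitPlane
  have hGan : AnalyticAt ℂ G ζ := by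
    have h1 : AnalyticAt ℂ (fun z => z / ζ) ζ := by fun_prop
    exact ((h1.clog hslit.self_of_nhds).add hM).sub analyticAt_const
  have hG0 : G ζ = 0 := by simp [hG, hζ0]
  have hGd : ∀ᶠ z in 𝓝 ζ, deriv G z = (z - ζ) * (κ z / z) := by
    filter_upwards [heq, hslit, hM.eventually_analyticAt, eventually_ne_nhds hζ0]
      with z hz1 hz2 hz3 hz0
    have h1 : HasDerivAt G (1 / ζ / (z / ζ) + deriv M z) z :=
      ((((hasDerivAt_id z).div_const ζ).clog hz2).add
        hz3.differentiableAt.hasDerivAt).sub_const _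
    rw [h1.deriv, mul_div_assoc', ← hz1]
    field_simp
  obtain ⟨g, hg, hg0, hGg⟩ := exists_eq_sq_mul hGan hG0 (hκ.div continuousAt_id hζ0) hGd
  set E : ℂ → ℂ := fun x => -(ζ ^ 2 * g (ζ * (1 - x)) / μ) with hEdef
  have hE : AnalyticAt ℂ E 0 := by
    have h1 : AnalyticAt ℂ (fun x : ℂ => ζ * (1 - x)) 0 := by fun_prop
    have h2 : AnalyticAt ℂ (fun x : ℂ => g (ζ * (1 - x))) 0 :=
      AnalyticAt.fun_comp (g := g) (by simpa using hg) h1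
    exact ((analyticAt_const.mul h2).div_const).neg
  have hd : ((1 / (2 * √b) : ℝ) : ℂ) ≠ 0 := by
    exact_mod_cast (by positivity : (0 : ℝ) < 1 / (2 * √b)).ne'
  have hE0 : E 0 = ((1 / (2 * √b) : ℝ) : ℂ) ^ 2 := by
    have h1 : ((1 / (2 * √b) : ℝ) : ℂ) ^ 2 = 1 / (4 * b) := by
      rw [← Complex.ofReal_pow, div_pow, mul_pow, Real.sq_sqrt hb.le]
      push_cast
      norm_num
    rw [h1]
    simp only [hEdef, sub_zero, mul_one, hg0]
    simp only [Pi.div_apply, id, hκ0]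
    field_simp
    norm_num
  obtain ⟨T, hT0, hT, hTE⟩ := exists_solution_sq hE hd hE0
  have hsqrtC := tendsto_ofReal_sqrt
  have hsqrtne : ∀ᶠ t : ℝ in 𝓝[>] 0, (√t : ℂ) ≠ 0 := by
    filter_upwards [self_mem_nhdsWithin] with t ht
    exact_mod_cast (Real.sqrt_pos.2 ht).ne'
  have hx : Tendsto (fun t : ℝ => T (√t : ℂ) / (√t : ℂ)) (𝓝[>] 0) (𝓝 ((2 * √b : ℝ) : ℂ)) := by
    have h1 := (hasDerivAt_iff_tendsto_slope.1 hT).comp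
      (tendsto_nhdsWithin_iff.2 ⟨hsqrtC, hsqrtne⟩)
    have h2 : (((1 / (2 * √b) : ℝ) : ℂ))⁻¹ = ((2 * √b : ℝ) : ℂ) := by
      rw [← Complex.ofReal_inv, one_div, inv_inv]
    rw [h2] at h1
    refine h1.congr fun t => ?_
    simp [slope_def_field, hT0]
  obtain ⟨h1, h2, h3⟩ := arc_of_tendsto_div_sqrt hζ (by positivity) hx
  refine ⟨fun t => ζ * (1 - T (√t : ℂ)), ?_, h2, h3⟩
  filter_upwards [h1, h2.eventually hGg, hsqrtC.eventually hTE, h2.eventually hslit,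
    self_mem_nhdsWithin] with t ht1 ht2 ht3 ht4 ht
  refine ⟨ht1, ?_⟩
  set v := ζ * (1 - T (√t : ℂ)) with hv
  -- `G (ζ (1 - x)) = -μ x² E(x)`, and `x = T √t` solves `x² E(x) = t`
  have h4 : G v = -μ * t := by
    have h5 : (√t : ℂ) ^ 2 = t := by
      rw [← Complex.ofReal_pow, Real.sq_sqrt (le_of_lt ht)]
    rw [h5] at ht3
    rw [ht2, ← ht3]
    simp only [hEdef, ← hv]
    field_simp
    rw [hv]
    ring
  have h6 := congrArg Complex.exp h4
  simp only [hG] at h6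
  rw [Complex.exp_sub, Complex.exp_add, Complex.exp_log (Complex.slitPlane_ne_zero ht4)] at h6
  rw [← h6]
  have := Complex.exp_ne_zero (M ζ)
  field_simp

/-! ### Traces of Koenigs functions -/

/-- The preimage under `φ` of the spiral `exp (-μ t) A`, `t > 0`, started at the boundary point
`ζ`. -/
noncomputable def spiralPreimage (φ : ℂ → ℂ) (μ A ζ : ℂ) (t : ℝ) : ℂ :=
  if 0 < t then Function.invFunOn φ disc (Complex.exp (-μ * t) * A) else ζ

/-- `v` is a germ at `0+` of a preimage under `φ` of the spiral `exp (-μ t) A`, which enters the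
disc from `ζ` along the normal. -/
structure IsNormalArc (φ : ℂ → ℂ) (μ A ζ : ℂ) (v : ℝ → ℂ) : Prop where
  eventually : ∀ᶠ t in 𝓝[>] 0, v t ∈ disc ∧ φ (v t) = Complex.exp (-μ * t) * A
  tendsto : Tendsto v (𝓝[>] 0) (𝓝 ζ)
  chord : Tendsto (fun t => (v t - ζ) / (‖v t - ζ‖ : ℂ)) (𝓝[>] 0) (𝓝 (-ζ))

namespace IsKoenigs

variable {p M φ : ℂ → ℂ} {A ζ : ℂ} {v : ℝ → ℂ}

/-- The spiral is in the image of `φ` for small times by hypothesis, then for all times by the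
invariance of the image. -/
lemma exp_mul_mem_of_arc (h : IsKoenigs p M φ) (hv : IsNormalArc φ (p 0) A ζ v) {t : ℝ}
    (ht : 0 < t) : Complex.exp (-p 0 * t) * A ∈ φ '' disc := by
  obtain ⟨s, ⟨hs1, hs2⟩, hs3⟩ := (hv.eventually.and (Ioo_mem_nhdsGT ht)).exists
  have h1 := h.exp_mul_mem_image ⟨v s, hs1, rfl⟩ (sub_nonneg.2 hs3.2.le)
  rw [hs2, ← mul_assoc, ← Complex.exp_add] at h1
  convert h1 using 3
  push_cast
  ring

lemma spiralPreimage_mem (h : IsKoenigs p M φ) (hv : IsNormalArc φ (p 0) A ζ v) {t : ℝ}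
    (ht : 0 < t) : spiralPreimage φ (p 0) A ζ t ∈ disc := by
  rw [spiralPreimage, if_pos ht]
  exact Function.invFunOn_mem (h.exp_mul_mem_of_arc hv ht)

lemma map_spiralPreimage (h : IsKoenigs p M φ) (hv : IsNormalArc φ (p 0) A ζ v) {t : ℝ}
    (ht : 0 < t) : φ (spiralPreimage φ (p 0) A ζ t) = Complex.exp (-p 0 * t) * A := by
  rw [spiralPreimage, if_pos ht]
  exact Function.invFunOn_eq (h.exp_mul_mem_of_arc hv ht)

lemma spiralPreimage_zero : spiralPreimage φ (p 0) A ζ 0 = ζ := by simp [spiralPreimage]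

lemma spiralPreimage_eventuallyEq (h : IsKoenigs p M φ) (hv : IsNormalArc φ (p 0) A ζ v) :
    v =ᶠ[𝓝[>] 0] spiralPreimage φ (p 0) A ζ := by
  filter_upwards [hv.eventually, self_mem_nhdsWithin] with t h1 ht
  exact h.injOn h1.1 (h.spiralPreimage_mem hv ht) (h1.2.trans (h.map_spiralPreimage hv ht).symm)

lemma hasDerivAt_spiralPreimage (h : IsKoenigs p M φ) (hv : IsNormalArc φ (p 0) A ζ v) {t : ℝ}
    (ht : 0 < t) : HasDerivAt (spiralPreimage φ (p 0) A ζ)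
      (-spiralPreimage φ (p 0) A ζ t * p (spiralPreimage φ (p 0) A ζ t)) t := by
  refine (h.hasDerivAt_orbit (h.spiralPreimage_mem hv ht)
    (h.map_spiralPreimage hv ht)).congr_of_eventuallyEq ?_
  filter_upwards [eventually_gt_nhds ht] with s hs
  rw [spiralPreimage, if_pos hs]

lemma spiralPreimage_ne_zero (h : IsKoenigs p M φ) (hv : IsNormalArc φ (p 0) A ζ v)
    (hA : A ≠ 0) {t : ℝ} (ht : 0 < t) : spiralPreimage φ (p 0) A ζ t ≠ 0 := by
  rw [Ne, ← h.eq_zero_iff (h.spiralPreimage_mem hv ht), h.map_spiralPreimage hv ht]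
  exact mul_ne_zero (Complex.exp_ne_zero _) hA

lemma tendsto_spiralPreimage_zero (h : IsKoenigs p M φ) (hv : IsNormalArc φ (p 0) A ζ v) :
    Tendsto (spiralPreimage φ (p 0) A ζ) (𝓝[>] 0) (𝓝 ζ) :=
  hv.tendsto.congr' (h.spiralPreimage_eventuallyEq hv)

lemma continuousOn_spiralPreimage (h : IsKoenigs p M φ) (hv : IsNormalArc φ (p 0) A ζ v) :
    ContinuousOn (spiralPreimage φ (p 0) A ζ) (Ici 0) := by
  intro t ht
  rcases eq_or_lt_of_le (mem_Ici.1 ht) with rfl | ht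
  · rw [← continuousWithinAt_Ioi_iff_Ici, ContinuousWithinAt, spiralPreimage_zero]
    exact h.tendsto_spiralPreimage_zero hv
  · exact (h.hasDerivAt_spiralPreimage hv ht).continuousAt.continuousWithinAt

lemma strictAntiOn_norm_spiralPreimage (h : IsKoenigs p M φ) (hv : IsNormalArc φ (p 0) A ζ v)
    (hA : A ≠ 0) : StrictAntiOn (fun t => ‖spiralPreimage φ (p 0) A ζ t‖) (Ici 0) := by
  have h1 : StrictAntiOn (fun t => ‖spiralPreimage φ (p 0) A ζ t‖ ^ 2) (Ici 0) := by
    refine strictAntiOn_of_deriv_neg (convex_Ici 0)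
      ((h.continuousOn_spiralPreimage hv).norm.pow 2) fun t ht => ?_
    rw [interior_Ici, mem_Ioi] at ht
    rw [(hasDerivAt_normSq_of_hasDerivAt rfl (h.hasDerivAt_spiralPreimage hv ht)).deriv]
    have h2 := h.re_pos _ (h.spiralPreimage_mem hv ht)
    have h3 := norm_pos_iff.2 (h.spiralPreimage_ne_zero hv hA ht)
    rw [neg_lt_zero]
    positivity
  exact fun s hs t ht hst => lt_of_pow_lt_pow_left₀ 2 (norm_nonneg _) (h1 hs ht hst)

lemma contDiffOn_spiralPreimage (h : IsKoenigs p M φ) (hv : IsNormalArc φ (p 0) A ζ v) :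
    ContDiffOn ℝ ∞ (spiralPreimage φ (p 0) A ζ) (Ioi 0) := by
  have h1 : DifferentiableOn ℂ (Function.invFunOn φ disc) (φ '' disc) := by
    rintro _ ⟨z, hz, rfl⟩
    exact (h.hasDerivAt_invFunOn hz).differentiableAt.differentiableWithinAt
  have h2 : ContDiffOn ℝ ∞ (Function.invFunOn φ disc) (φ '' disc) :=
    (h1.contDiffOn h.isOpen_image).restrict_scalars ℝ
  have h3 : ContDiff ℝ ∞ fun t : ℝ => Complex.exp (-p 0 * t) * A := by
    have h4 : ContDiff ℝ ∞ fun t : ℝ => (t : ℂ) := Complex.ofRealCLM.contDiff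
    exact ((contDiff_const.mul h4).cexp).mul contDiff_const
  refine (h2.comp h3.contDiffOn fun t (ht : 0 < t) => h.exp_mul_mem_of_arc hv ht).congr
    fun t (ht : 0 < t) => ?_
  rw [spiralPreimage, if_pos ht]
  rfl

lemma isSmoothCurveInDiscFrom (h : IsKoenigs p M φ) (hv : IsNormalArc φ (p 0) A ζ v)
    (hA : A ≠ 0) : IsSmoothCurveInDiscFrom ζ (spiralPreimage φ (p 0) A ζ) := by
  refine ⟨spiralPreimage_zero, h.continuousOn_spiralPreimage hv, fun s hs t ht hst => ?_,
    fun t ht => h.spiralPreimage_mem hv ht, h.contDiffOn_spiralPreimage hv, fun t ht => ?_⟩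
  · exact (h.strictAntiOn_norm_spiralPreimage hv hA).injOn hs ht (congrArg norm hst)
  · rw [(h.hasDerivAt_spiralPreimage hv ht).deriv]
    exact mul_ne_zero (neg_ne_zero.2 (h.spiralPreimage_ne_zero hv hA ht))
      (h.ne_zero (h.spiralPreimage_mem hv ht))

/-- The direction of the velocity `-γ p(γ)` is obtained from that of the chord, since `p` has a
simple pole at `ζ` with residue on the ray through `-ζ`. -/
lemma startsPerpendicularly (h : IsKoenigs p M φ) (hv : IsNormalArc φ (p 0) A ζ v)
    (hζ : ‖ζ‖ = 1) {r : ℝ} (hr : 0 < r)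
    (hp : Tendsto (fun z => p z * (ζ - z)) (𝓝[≠] ζ) (𝓝 (r * ζ))) :
    StartsPerpendicularly ζ (spiralPreimage φ (p 0) A ζ) := by
  have hζ0 : ζ ≠ 0 := fun h => by simp [h] at hζ
  have hr' : (r : ℂ) ≠ 0 := by exact_mod_cast hr.ne'
  set γ := spiralPreimage φ (p 0) A ζ with hγ
  have hchord : Tendsto (fun t => (γ t - ζ) / (‖γ t - ζ‖ : ℂ)) (𝓝[>] 0) (𝓝 (-ζ)) := by
    refine hv.chord.congr' ?_
    filter_upwards [h.spiralPreimage_eventuallyEq hv] with t ht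
    rw [ht]
  refine ⟨hchord, ?_⟩
  have hne : ∀ᶠ t in 𝓝[>] (0 : ℝ), γ t ≠ ζ := by
    filter_upwards [self_mem_nhdsWithin] with t ht hγt
    have := mem_disc.1 (h.spiralPreimage_mem hv ht)
    rw [← hγ, hγt, hζ] at this
    exact lt_irrefl _ this
  have hlim := h.tendsto_spiralPreimage_zero hv
  have hpole : Tendsto (fun t => γ t * (p (γ t) * (ζ - γ t))) (𝓝[>] 0) (𝓝 (ζ * (r * ζ))) :=
    hlim.mul (hp.comp (tendsto_nhdsWithin_iff.2 ⟨hlim, hne⟩))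
  have hnorm : ‖ζ * (r * ζ)‖ = r := by
    rw [norm_mul, norm_mul, hζ, Complex.norm_of_nonneg hr.le]
    ring
  have h1 := (hpole.div ((Complex.continuous_ofReal.tendsto _).comp hpole.norm)
    (by rw [hnorm]; exact hr')).div hchord (neg_ne_zero.2 hζ0)
  have h2 : ζ * (r * ζ) / ((‖ζ * (r * ζ)‖ : ℝ) : ℂ) / -ζ = -ζ := by
    rw [hnorm]
    field_simp
  rw [h2] at h1
  refine h1.congr' ?_
  filter_upwards [self_mem_nhdsWithin, hne] with t ht hγt
  rw [(h.hasDerivAt_spiralPreimage hv ht).deriv, ← hγ]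
  simp only [Pi.div_apply, Function.comp]
  have hsub : ζ - γ t ≠ 0 := sub_ne_zero.2 (Ne.symm hγt)
  have hsub' : ((‖ζ - γ t‖ : ℝ) : ℂ) ≠ 0 := by exact_mod_cast (norm_pos_iff.2 hsub).ne'
  rw [← neg_sub ζ (γ t), norm_neg, neg_mul, norm_neg, norm_mul, norm_mul, norm_mul]
  push_cast
  field_simp

lemma tendsto_spiralPreimage_atTop (h : IsKoenigs p M φ) :
    Tendsto (spiralPreimage φ (p 0) A ζ) atTop (𝓝 0) := by
  have h1 : Tendsto (fun t : ℝ => Complex.exp (-p 0 * t) * A) atTop (𝓝 0) := by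
    have h2 : Tendsto (fun t : ℝ => Complex.exp (-p 0 * t)) atTop (𝓝 0) := by
      rw [tendsto_zero_iff_norm_tendsto_zero]
      simp only [Complex.norm_exp]
      refine Real.tendsto_exp_atBot.comp ?_
      have h3 := tendsto_id.const_mul_atTop_of_neg (neg_lt_zero.2 (h.re_pos 0 zero_mem_disc))
      simpa using h3
    simpa using h2.mul_const A
  have h4 := h.continuousAt_invFunOn zero_mem_disc
  rw [ContinuousAt, h.invFunOn_apply zero_mem_disc, h.map_zero] at h4
  refine (h4.comp h1).congr' ?_
  filter_upwards [eventually_gt_atTop 0] with t ht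
  rw [spiralPreimage, if_pos ht]
  rfl

/-- Taking logarithms in `γ exp (M γ) = exp (-p(0) t) ζ exp (M ζ)` gives the continuous argument
`arg ζ + Im (M ζ - M γ) - t Im p(0)`, whose derivative `-Im p(γ)` tends to `-Im p(0)`. -/
lemma spiralsAboutOrigin (h : IsKoenigs p M φ)
    (hv : IsNormalArc φ (p 0) (ζ * Complex.exp (M ζ)) ζ v) (hζ : ‖ζ‖ = 1)
    (hM : ContinuousAt M ζ) {a : ℝ} (ha : (p 0).im = -a) :
    SpiralsAboutOrigin a (spiralPreimage φ (p 0) (ζ * Complex.exp (M ζ)) ζ) := by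
  have hζ0 : ζ ≠ 0 := fun h => by simp [h] at hζ
  have hA : ζ * Complex.exp (M ζ) ≠ 0 := mul_ne_zero hζ0 (Complex.exp_ne_zero _)
  have hzero := h.tendsto_spiralPreimage_atTop (A := ζ * Complex.exp (M ζ)) (ζ := ζ)
  refine ⟨h.strictAntiOn_norm_spiralPreimage hv hA, by simpa using hzero.norm, ?_⟩
  set γ := spiralPreimage φ (p 0) (ζ * Complex.exp (M ζ)) ζ with hγ
  set L : ℝ → ℂ := fun t => Complex.log ζ + (M ζ - M (γ t)) - p 0 * t with hL
  have hexp : ∀ t : ℝ, 0 ≤ t → γ t = Complex.exp (L t) := by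
    intro t ht
    simp only [hL]
    rw [Complex.exp_sub, Complex.exp_add, Complex.exp_log hζ0]
    rcases eq_or_lt_of_le ht with rfl | ht
    · simp [hγ, spiralPreimage_zero]
    · have h1 := h.map_spiralPreimage hv ht
      rw [h.phi _ (h.spiralPreimage_mem hv ht), ← hγ, neg_mul, Complex.exp_neg] at h1
      have h2 := Complex.exp_ne_zero (M (γ t))
      rw [Complex.exp_sub]
      field_simp at h1 ⊢
      linear_combination h1
  have hMγ : ContinuousOn (fun t => M (γ t)) (Ici 0) := by
    intro t ht
    refine ContinuousAt.comp_continuousWithinAt (g := M) ?_ (h.continuousOn_spiralPreimage hv t ht)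
    rcases eq_or_lt_of_le (mem_Ici.1 ht) with rfl | ht
    · rwa [hγ, spiralPreimage_zero]
    · exact (h.hasDerivAt_M (h.spiralPreimage_mem hv ht)).continuousAt
  have hLc : ContinuousOn (fun t => (L t).im) (Ici 0) := by
    refine Complex.continuous_im.comp_continuousOn ?_
    exact (continuousOn_const.add (continuousOn_const.sub hMγ)).sub (by fun_prop)
  have hLd : ∀ t : ℝ, 0 < t → HasDerivAt (fun t => (L t).im) (-(p (γ t)).im) t := by
    intro t ht
    have hmem := h.spiralPreimage_mem hv ht
    have h1 : HasDerivAt (fun t => M (γ t)) (deriv M (γ t) * (-γ t * p (γ t))) t :=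
      (h.hasDerivAt_M hmem).comp_of_eq t (h.hasDerivAt_spiralPreimage hv ht) rfl
    have h2 : HasDerivAt (fun t : ℝ => p 0 * (t : ℂ)) (p 0) t := by
      simpa using ((hasDerivAt_id (t : ℂ)).const_mul (p 0)).comp_ofReal
    have h3 : HasDerivAt L (-p (γ t)) t := by
      refine (((h1.const_sub (M ζ)).const_add (Complex.log ζ)).sub h2).congr_deriv ?_
      have h4 := h.eq _ hmem
      rw [← hγ] at h4
      linear_combination h4
    exact (Complex.imCLM.hasFDerivAt.comp_hasDerivAt t h3).congr_deriv (by simp)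
  have hpim : Tendsto (fun t => -(p (γ t)).im) atTop (𝓝 a) := by
    have h1 : ContinuousAt p 0 := h.cont.continuousAt (disc_mem_nhds zero_mem_disc)
    have h2 := ((Complex.continuous_im.tendsto _).comp (h1.tendsto.comp hzero)).neg
    rwa [ha, neg_neg] at h2
  have hbdd : Tendsto (fun t => (Complex.log ζ + (M ζ - M (γ t))).im) atTop
      (𝓝 (Complex.log ζ + (M ζ - M 0)).im) := by
    have h1 := (h.hasDerivAt_M zero_mem_disc).continuousAt.tendsto.comp hzero
    exact (Complex.continuous_im.tendsto _).comp ((h1.const_sub (M ζ)).const_add (Complex.log ζ))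
  have hLim : ∀ t : ℝ, (L t).im = (Complex.log ζ + (M ζ - M (γ t))).im + a * t := by
    intro t
    simp only [hL]
    rw [Complex.sub_im, Complex.im_mul_ofReal, ha]
    ring
  refine ⟨fun t => (L t).im, hLc, fun t ht => ⟨?_, ?_⟩, fun hpos => ⟨?_, ?_⟩, fun hneg => ⟨?_, ?_⟩⟩
  · rw [hexp t ht]
    exact Complex.exp_ne_zero _
  · rw [hexp t ht, Complex.norm_exp, Complex.ofReal_exp, ← Complex.exp_add]
    congr 1
    rw [mul_comm, Complex.re_add_im]
  · simp only [hLim]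
    exact hbdd.add_atTop (tendsto_id.const_mul_atTop hpos)
  · obtain ⟨T, hT⟩ := eventually_atTop.1
      ((hpim.eventually_const_lt hpos).and (eventually_gt_atTop 0))
    refine ⟨T, strictMonoOn_of_deriv_pos (convex_Ici T)
      (hLc.mono (Ici_subset_Ici.2 (hT T le_rfl).2.le)) fun t ht => ?_⟩
    have h1 := hT t (interior_subset ht)
    rw [(hLd t h1.2).deriv]
    exact h1.1
  · simp only [hLim]
    exact hbdd.add_atBot (tendsto_id.const_mul_atTop_of_neg hneg)
  · obtain ⟨T, hT⟩ := eventually_atTop.1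
      ((hpim.eventually_lt_const hneg).and (eventually_gt_atTop 0))
    refine ⟨T, strictAntiOn_of_deriv_neg (convex_Ici T)
      (hLc.mono (Ici_subset_Ici.2 (hT T le_rfl).2.le)) fun t ht => ?_⟩
    have h1 := hT t (interior_subset ht)
    rw [(hLd t h1.2).deriv]
    exact h1.1

lemma isTrace (h : IsKoenigs p M φ) {β a : ℝ} (hp : p 0 = β - Complex.I * a)
    (hv : IsNormalArc φ (p 0) (ζ * Complex.exp (M ζ)) ζ v) (hM : ContinuousAt M ζ) :
    IsTrace (flow φ β a) a ζ (spiralPreimage φ (p 0) (ζ * Complex.exp (M ζ)) ζ) := by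
  intro t ht
  rcases eq_or_lt_of_le ht with rfl | ht
  · rw [spiralPreimage_zero]
    have h1 : Tendsto (fun z : ℂ => z) (𝓝[disc] ζ) (𝓝 ζ) := nhdsWithin_le_nhds
    simp only [Complex.ofReal_zero, mul_zero, Complex.exp_zero, one_mul]
    refine h1.congr' ?_
    filter_upwards [self_mem_nhdsWithin] with z hz
    exact (h.flow_zero hz).symm
  · have hrot : Tendsto (fun z => Complex.exp (-(Complex.I * a * t)) * z)
        (𝓝[disc] (Complex.exp (Complex.I * a * t) * ζ)) (𝓝[disc] ζ) := by
      refine tendsto_nhdsWithin_iff.2 ⟨?_, ?_⟩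
      · have h1 : Continuous fun z => Complex.exp (-(Complex.I * a * t)) * z := by fun_prop
        refine (h1.tendsto' _ _ ?_).mono_left nhdsWithin_le_nhds
        rw [← mul_assoc, ← Complex.exp_add, neg_add_cancel, Complex.exp_zero, one_mul]
      · filter_upwards [self_mem_nhdsWithin] with z hz using exp_mul_mem_disc hz t
    have hφ : Tendsto φ (𝓝[disc] ζ) (𝓝 (ζ * Complex.exp (M ζ))) := by
      have h1 : ContinuousAt (fun z => z * Complex.exp (M z)) ζ := by fun_prop
      refine (h1.tendsto.mono_left nhdsWithin_le_nhds).congr' ?_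
      filter_upwards [self_mem_nhdsWithin] with z hz using (h.phi z hz).symm
    have h2 := (hφ.comp hrot).const_mul (Complex.exp (-p 0 * t))
    have h3 := h.continuousAt_invFunOn (h.spiralPreimage_mem hv ht)
    rw [ContinuousAt, h.map_spiralPreimage hv ht] at h3
    have h4 := h3.comp h2
    rw [spiralPreimage, if_pos ht]
    rw [hp] at h4 ⊢
    exact h4

end IsKoenigs

/-! ### The points `ζₖ` -/

section Traces

variable {n : ℕ} {ζ ξ : Fin n → ℂ} {b : Fin n → ℝ} {a : ℝ}

/-- `h(z) (ζₖ - z) → 2 bₖ ζₖ` as `z → ζₖ`, for the Herglotz function `h`. -/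
lemma tendsto_herglotz_mul_sub (hinj : Function.Injective ζ) (k : Fin n) (c : ℂ) :
    Tendsto (fun z => (herglotz ζ b z - c) * (ζ k - z)) (𝓝[≠] (ζ k))
      (𝓝 ((2 * b k : ℝ) * ζ k)) := by
  have hcont : ContinuousAt (fun z => (b k : ℂ) * (ζ k + z) + (ζ k - z) *
      ((∑ j ∈ Finset.univ.erase k, (b j : ℂ) * ((ζ j + z) / (ζ j - z))) - c)) (ζ k) := by
    refine ContinuousAt.add (by fun_prop) (ContinuousAt.mul (by fun_prop)
      (ContinuousAt.sub (tendsto_finsetSum _ fun j hj => ?_) continuousAt_const))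
    have hjk : ζ j - ζ k ≠ 0 := sub_ne_zero.2 fun h => (Finset.ne_of_mem_erase hj) (hinj h)
    exact ContinuousAt.mul continuousAt_const (ContinuousAt.div (by fun_prop) (by fun_prop) hjk)
  have h1 := hcont.tendsto.mono_left (nhdsWithin_le_nhds (s := {ζ k}ᶜ))
  have h2 : (b k : ℂ) * (ζ k + ζ k) + (ζ k - ζ k) *
      ((∑ j ∈ Finset.univ.erase k, (b j : ℂ) * ((ζ j + ζ k) / (ζ j - ζ k))) - c) =
      (2 * b k : ℝ) * ζ k := by
    push_cast
    ring
  rw [h2] at h1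
  refine h1.congr' ?_
  filter_upwards [self_mem_nhdsWithin] with z hz
  have hz' : ζ k - z ≠ 0 := sub_ne_zero.2 (Ne.symm hz)
  rw [herglotz, ← Finset.add_sum_erase _ _ (Finset.mem_univ k)]
  field_simp
  ring

lemma Q_sub_R_apply_self_ne_zero (hζ : ∀ k, ‖ζ k‖ = 1) (hinj : Function.Injective ζ)
    (hb : ∀ k, 0 < b k) (k : Fin n) : Q ζ b (ζ k) - Complex.I * a * R ζ (ζ k) ≠ 0 := by
  have h0 : ζ k ≠ 0 := fun h => by simpa [h] using hζ k
  have hb' : (b k : ℂ) ≠ 0 := by exact_mod_cast (hb k).ne'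
  rw [R_apply_self, Q_apply_self, mul_zero, sub_zero]
  exact mul_ne_zero (mul_ne_zero hb' (mul_ne_zero two_ne_zero h0)) (prod_erase_sub_ne_zero hinj k)

lemma analyticAt_logProduct {α : Fin n → ℝ} {c z : ℂ}
    (h : ∀ k, 1 - z / ξ k ∈ Complex.slitPlane) : AnalyticAt ℂ (logProduct ξ α c) z := by
  refine analyticAt_const.mul (Finset.analyticAt_fun_sum _ fun k _ => analyticAt_const.mul ?_)
  exact AnalyticAt.clog (by fun_prop) (h k)

/-- All the branches extend analytically to the points `ζₖ`, and the logarithmic derivative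
`(b - ia) R / (z (Q - iaR))` of `z exp (M z)` has a simple zero there. -/
lemma IsRootList.exists_arc_self (h : IsRootList ζ b a ξ) (hn : 1 ≤ n) (hζ : ∀ k, ‖ζ k‖ = 1)
    (hinj : Function.Injective ζ) (hb : ∀ k, 0 < b k) (hk : ∀ k j, ζ j - ξ k ≠ 0) {M : ℂ → ℂ}
    {C : ℂ} (hM : M = fun z => logProduct ξ (exponent ζ b a ξ)
      (Complex.exp (-(Complex.I * Real.arctan (a / ∑ j, b j)))) z + C) (k : Fin n) :
    ContinuousAt M (ζ k) ∧ ∃ v : ℝ → ℂ, (∀ᶠ t in 𝓝[>] 0, v t ∈ disc ∧ v t * Complex.exp (M (v t)) =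
        Complex.exp (-(((∑ k, b k : ℝ) : ℂ) - Complex.I * a) * (t : ℂ)) *
          (ζ k * Complex.exp (M (ζ k)))) ∧
      Tendsto v (𝓝[>] 0) (𝓝 (ζ k)) ∧
      Tendsto (fun t => (v t - ζ k) / (‖v t - ζ k‖ : ℂ)) (𝓝[>] 0) (𝓝 (-ζ k)) := by
  have hξ := fun k => h.norm_eq_one hn hζ hb (hk k)
  have h0 := h.ne_zero hn hζ hb hk
  have hslit : ∀ j, 1 - ζ k / ξ j ∈ Complex.slitPlane := fun j =>
    one_sub_div_mem_slitPlane (hξ j) (hζ k).le fun hz => hk j k (by linear_combination -hz)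
  have hMan : AnalyticAt ℂ M (ζ k) := by
    rw [hM]
    exact (analyticAt_logProduct hslit).add analyticAt_const
  refine ⟨hMan.continuousAt, ?_⟩
  have hPne := Q_sub_R_apply_self_ne_zero (a := a) hζ hinj hb k
  set μ : ℂ := ((∑ k, b k : ℝ) : ℂ) - Complex.I * a with hμ
  have hμ0 : μ ≠ 0 := by
    intro hz
    have h1 := congrArg Complex.re hz
    have h2 := sum_pos_of_pos hn hb
    simp [hμ] at h1
    linarith
  have hPc : Continuous fun z => Q ζ b z - Complex.I * a * R ζ z := by
    unfold Q R
    fun_prop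
  refine exists_arc (κ := fun z => -(μ * ∏ j ∈ Finset.univ.erase k, (ζ j - z)) /
    (Q ζ b z - Complex.I * a * R ζ z)) (hζ k) hμ0 (hb k) hMan ?_ ?_ ?_
  · exact ContinuousAt.div (by fun_prop) hPc.continuousAt hPne
  · have h1 := prod_erase_sub_ne_zero hinj k
    have h2 : ζ k ≠ 0 := fun h => by simpa [h] using hζ k
    have hb' : (b k : ℂ) ≠ 0 := by exact_mod_cast (hb k).ne'
    rw [R_apply_self, Q_apply_self, mul_zero, sub_zero]
    field_simp
  · have hslit' : ∀ᶠ z in 𝓝 (ζ k), ∀ j, 1 - z / ξ j ∈ Complex.slitPlane := by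
      refine eventually_all.2 fun j => ?_
      have h1 : ContinuousAt (fun z => 1 - z / ξ j) (ζ k) := by fun_prop
      exact h1.tendsto (Complex.isOpen_slitPlane.mem_nhds (hslit j))
    filter_upwards [hslit', hPc.continuousAt.eventually_ne hPne] with z hz hPz
    have h1 := h.one_add_mul hn hζ hb hk (z := z) fun j hj => by
      have h2 := Complex.slitPlane_ne_zero (hz j)
      rw [sub_eq_zero.1 hj, div_self (h0 j), sub_self] at h2
      exact h2 rfl
    rw [hM, ((hasDerivAt_logProduct h0 hz).add_const C).deriv, mul_div_assoc', eq_div_iff hPz, h1,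
      R, ← Finset.mul_prod_erase _ _ (Finset.mem_univ k)]
    ring

end Traces

end RadialLoewner

open RadialLoewner in
theorem mainTheorem1 (n : ℕ) (hn : 1 ≤ n) (ζ : Fin n → ℂ) (hζ : ∀ k, ‖ζ k‖ = 1)
    (hζ_inj : Function.Injective ζ) (b : Fin n → ℝ) (hb : ∀ k, 0 < b k) (a : ℝ) :
    ∃ (ξ : Fin n → ℂ) (α : Fin n → ℝ),
      -- the points `ξₖ` and the exponents `αₖ`
      RadialLoewner.IsRootList ζ b a ξ ∧
      (∀ k, ‖ξ k‖ = 1) ∧ Function.Injective ξ ∧ (∀ k j, ξ k ≠ ζ j) ∧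
      (∀ k, RadialLoewner.residue ζ ξ k =
        2 * (-1) ^ (n - 1) * Complex.exp (Complex.I * Real.arctan (a / ∑ j, b j)) * α k) ∧
      (∀ k, α k < 0) ∧ ∑ k, α k = -Real.cos (Real.arctan (a / ∑ j, b j)) ∧
      -- the function `φ`: branches exist, and the claims hold for each of them
      (∃ φ, RadialLoewner.IsPowerProduct ξ α
        (Complex.exp (Complex.I *
          (RadialLoewner.arccot (a / ∑ j, b j) - Real.pi / 2 : ℝ))) φ) ∧
      ∀ φ, RadialLoewner.IsPowerProduct ξ α
          (Complex.exp (Complex.I *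
            (RadialLoewner.arccot (a / ∑ j, b j) - Real.pi / 2 : ℝ))) φ →
        RadialLoewner.IsSpirallike (RadialLoewner.arccot (a / ∑ j, b j) - Real.pi / 2) φ ∧
        -- the flow is well defined, and it is the unique solution
        (∀ z ∈ RadialLoewner.disc, ∀ t : ℝ, 0 ≤ t →
          Complex.exp (-(((∑ j, b j : ℝ) : ℂ) - Complex.I * a) * t) *
            φ (Complex.exp (-(Complex.I * a * t)) * z) ∈ φ '' RadialLoewner.disc) ∧
        RadialLoewner.IsSolution ζ b a (RadialLoewner.flow φ (∑ j, b j) a) ∧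
        (∀ g, RadialLoewner.IsSolution ζ b a g →
          ∀ z ∈ RadialLoewner.disc, ∀ t : ℝ, 0 ≤ t →
            g z t = RadialLoewner.flow φ (∑ j, b j) a z t) ∧
        -- the traces
        ∀ k, ∃ γ : ℝ → ℂ,
          RadialLoewner.IsTrace (RadialLoewner.flow φ (∑ j, b j) a) a (ζ k) γ ∧
          RadialLoewner.IsSmoothCurveInDiscFrom (ζ k) γ ∧
          RadialLoewner.StartsPerpendicularly (ζ k) γ ∧
          (a ≠ 0 → RadialLoewner.SpiralsAboutOrigin a γ) := by
  have hβ := sum_pos_of_pos hn hb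
  obtain ⟨ξ, h⟩ := exists_isRootList hn ζ b hβ a
  have hk := h.sub_ne_zero hζ hζ_inj hb
  have hξ := fun k => h.norm_eq_one hn hζ hb (hk k)
  have hψ : arccot (a / ∑ j, b j) - Real.pi / 2 = -Real.arctan (a / ∑ j, b j) := by
    rw [arccot]
    ring
  rw [hψ]
  have hc : Complex.exp (Complex.I * (-Real.arctan (a / ∑ j, b j) : ℝ)) =
      Complex.exp (-(Complex.I * Real.arctan (a / ∑ j, b j))) := by
    rw [Complex.ofReal_neg, mul_neg]
  rw [hc]
  refine ⟨ξ, exponent ζ b a ξ, h, hξ, h.injective hn hζ hb hk,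
    fun k j hkj => hk k j (by rw [hkj, sub_self]), h.residue_eq_exponent hn hζ hb hk,
    exponent_neg hn hb hk, h.sum_exponent hn hζ hb hk, exists_isPowerProduct hξ _ _, fun φ hφ => ?_⟩
  obtain ⟨C, hC⟩ := hφ.exists_eq hξ
  have hK := h.isKoenigs hn hζ hb hk hC
  set p : ℂ → ℂ := fun z => herglotz ζ b z - Complex.I * a with hp
  set M : ℂ → ℂ := fun z => logProduct ξ (exponent ζ b a ξ)
    (Complex.exp (-(Complex.I * Real.arctan (a / ∑ j, b j)))) z + C with hM
  have hp0 : p 0 = ((∑ j, b j : ℝ) : ℂ) - Complex.I * a := by rw [hp]; simp only [herglotz_zero hζ]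
  -- in the frame rotating with the measures the driving term does not depend on time
  have hrot : ∀ (z : ℂ) (t : ℝ), ∑ k, (b k : ℂ) * ((Complex.exp (Complex.I * a * t) * ζ k + z) /
      (Complex.exp (Complex.I * a * t) * ζ k - z)) =
      p (Complex.exp (-(Complex.I * a * t)) * z) + Complex.I * a := by
    intro z t
    rw [hp]
    simp only [sub_add_cancel, herglotz]
    refine Finset.sum_congr rfl fun k _ => ?_
    have he := Complex.exp_ne_zero (Complex.I * a * t)
    have h1 : z = Complex.exp (Complex.I * a * t) * (Complex.exp (-(Complex.I * a * t)) * z) := by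
      rw [← mul_assoc, ← Complex.exp_add, add_neg_cancel, Complex.exp_zero, one_mul]
    conv_lhs => rw [h1]
    rw [← mul_add, ← mul_sub, mul_div_mul_left _ _ he]
  refine ⟨hK.isSpirallike ⟨?_, ?_⟩ ?_, fun z hz t ht => hK.flow_arg_mem hp0 hz ht,
    ⟨hK.continuousOn_flow hp0, fun t ht z hz =>
      (hK.hasDerivAt_flow_fst hp0 hz ht).differentiableAt.differentiableWithinAt,
      fun z hz => hK.flow_zero hz, fun z hz t ht => ?_⟩, fun g hg z hz t ht => ?_, fun k => ?_⟩
  · linarith [Real.arctan_lt_pi_div_two (a / ∑ j, b j)]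
  · linarith [Real.neg_pi_div_two_lt_arctan (a / ∑ j, b j)]
  · have hq := div_pos hβ (Real.cos_arctan_pos (a / ∑ j, b j))
    rw [hc, hp0, sub_I_mul_eq hβ, norm_mul, Complex.norm_of_nonneg hq.le, Complex.norm_exp]
    generalize Real.arctan (a / ∑ j, b j) = x
    simp
  · rw [hrot]
    exact (hK.hasDerivAt_flow_snd hp0 hz ht).hasDerivWithinAt
  · obtain ⟨hg1, hg2, hg3, hg4⟩ := hg
    refine hK.eq_flow hp0 hg1 hg2 hg3 (fun w hw s hs => ?_) hz ht
    rw [← hrot]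
    exact hg4 w hw s hs
  · obtain ⟨hMc, v, hv1, hv2, hv3⟩ := h.exists_arc_self hn hζ hζ_inj hb hk hM k
    have hv : IsNormalArc φ (p 0) (ζ k * Complex.exp (M (ζ k))) (ζ k) v := by
      refine ⟨hv1.mono fun t ht => ⟨ht.1, ?_⟩, hv2, hv3⟩
      rw [hK.phi _ ht.1, ht.2, hp0]
    have hA : ζ k * Complex.exp (M (ζ k)) ≠ 0 :=
      mul_ne_zero (fun h => by simpa [h] using hζ k) (Complex.exp_ne_zero _)
    refine ⟨spiralPreimage φ (p 0) (ζ k * Complex.exp (M (ζ k))) (ζ k), hK.isTrace hp0 hv hMc,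
      hK.isSmoothCurveInDiscFrom hv hA, hK.startsPerpendicularly hv (hζ k)
        (mul_pos two_pos (hb k)) (tendsto_herglotz_mul_sub hζ_inj k _),
      fun _ => hK.spiralsAboutOrigin hv (hζ k) hMc ?_⟩
    rw [hp0]
    simp
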